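/- Let $k$ be a field of characteristic $0$. Let $W_{\ge -1}=\mathrm{Der}(k[t])=k[t]\partial$, where $\partial=d/dt$, with bracket $[f\partial,g\partial]=(fg'-f'g)\partial$, and put $e_i=t^{i+1}\partial$ for $i\ge -1$. For $n\ge 0$ let $W_{\ge n}=\mathrm{span}_k\{e_i : i\ge n\}$, which is a Lie ideal of $W_{\ge 0}$, let $\mathfrak g_n=W_{\ge 0}/W_{\ge n}$, and let $v_i=e_i+W_{\ge n}\in\mathfrak g_n$ for $0\le i\le n-1$. Let $A_1=k\langle t,\partial\rangle/(\partial t-t\partial-1)$ be the first Weyl algebra and $T_n=A_1\otimes_k U(\mathfrak g_n)$, where $U$ denotes the universal enveloping algebra. The $n$-th orbit homomorphism is the $k$-algebra homomorphism $$\Psi_n:U(W_{\ge -1})\to T_n,\qquad f\partial\mapsto f\partial+\sum_{i=0}^{n-1}\frac{f^{(i+1)}}{(i+1)!}\,v_i\qquad(f\in k[t]),$$ and $B_n=\Psi_n(U(W_{\ge -1}))$ is its image. Grade $T_n$ by $\mathbb Z$ by letting the ordered monomial $t^a\partial^b v_0^{m_0}\cdots v_{n-1}^{m_{n-1}}$ have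 degree $a-b+\sum_{i=0}^{n-1} i\,m_i$; let $(T_n)_0$ be the span of the ordered monomials of degree $0$, a subalgebra of $T_n$, and let $(B_n)_0=B_n\cap (T_n)_0$ be the subring of degree zero elements of $B_n$. Theorem. For every $n\ge 0$, the ring $(B_n)_0$ is a left and right Noetherian domain. -/

import Mathlib

open Polynomial
open scoped TensorProduct

namespace OrbitHom

section

attribute [local instance 100] LieRing.ofAssociativeRing

variable (k : Type*) [Field k]

/-! ### The one-sided Witt algebra and its subquotients -/

/-- The one-sided Witt algebra `W_{≥ -1} = Der(k[t])`, with the commutator bracket. -/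
abbrev Witt : Type _ := Derivation k k[X] k[X]

/-- The vector field `f ∂`, where `∂ = d/dt`. -/
noncomputable def vf (f : k[X]) : Witt k := Polynomial.mkDerivation k f

/-- The basis elements `e_i = t^(i+1) ∂`, for `i ≥ 0`. -/
noncomputable def e (i : ℕ) : Witt k := vf k (X ^ (i + 1))

/-- The linear span `W_{≥ n}` of the `e_i` with `i ≥ n`, for `n ≥ 0`. -/
noncomputable def wittSpan (n : ℕ) : Submodule k (Witt k) :=
  Submodule.span k {D | ∃ i : ℕ, n ≤ i ∧ D = e k i}

variable {k}

theorem vf_apply_X (f : k[X]) : vf k f X = f := by simp [vf]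

theorem vf_X_eq (D : Witt k) : vf k (D X) = D :=
  Polynomial.derivation_ext (by simp [vf])

theorem vf_apply (f g : k[X]) : vf k f g = derivative g * f := by
  simp [vf, Polynomial.mkDerivation_apply]

theorem apply_eq (D : Witt k) (g : k[X]) : D g = derivative g * D X := by
  conv_lhs => rw [← vf_X_eq D]
  rw [vf_apply]

theorem bracket_apply_X (D E : Witt k) :
    ⁅D, E⁆ X = D X * derivative (E X) - derivative (D X) * E X := by
  rw [Derivation.commutator_apply, apply_eq D (E X), apply_eq E (D X)]
  ring

/-- `f ∂` lies in `W_{≥ n}` exactly when `t^(n+1)` divides `f`. -/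
theorem mem_wittSpan {n : ℕ} {D : Witt k} : D ∈ wittSpan k n ↔ X ^ (n + 1) ∣ D X := by
  constructor
  · intro h
    induction h using Submodule.span_induction with
    | mem D h =>
      obtain ⟨i, hi, rfl⟩ := h
      rw [e, vf_apply_X]
      exact pow_dvd_pow _ (by omega)
    | zero => simp
    | add D E _ _ hD hE => exact dvd_add hD hE
    | smul c D _ hD =>
      rw [Derivation.smul_apply, Polynomial.smul_eq_C_mul]
      exact Dvd.dvd.mul_left hD _
  · rintro ⟨q, hq⟩
    rw [← vf_X_eq D, hq]
    induction q using Polynomial.induction_on' generalizing D with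
    | add p q hp hq' =>
      rw [mul_add]
      have h1 := hp (D := vf k (X ^ (n + 1) * p)) (vf_apply_X _)
      have h2 := hq' (D := vf k (X ^ (n + 1) * q)) (vf_apply_X _)
      have h3 := Submodule.add_mem _ h1 h2
      simpa only [vf, ← map_add] using h3
    | monomial j a =>
      have : vf k (X ^ (n + 1) * monomial j a) = a • e k (n + j) := by
        refine Polynomial.derivation_ext ?_
        rw [Derivation.smul_apply, e, vf_apply_X, vf_apply_X, ← C_mul_X_pow_eq_monomial,
          Polynomial.smul_eq_C_mul]
        ring
      rw [this]
      exact Submodule.smul_mem _ _ (Submodule.subset_span ⟨n + j, by omega, rfl⟩)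

theorem lie_mem_wittSpan {n : ℕ} {D E : Witt k} (hD : D ∈ wittSpan k 0)
    (hE : E ∈ wittSpan k n) : ⁅D, E⁆ ∈ wittSpan k n := by
  rw [mem_wittSpan] at *
  rw [bracket_apply_X]
  obtain ⟨p, hp⟩ := hD
  obtain ⟨q, hq⟩ := hE
  refine dvd_sub ?_ (Dvd.dvd.mul_left ⟨q, hq⟩ _)
  rw [hp, hq]
  refine ⟨p * ((n + 1 : k[X]) * q + X * derivative q), ?_⟩
  simp only [derivative_mul, derivative_X_pow, Nat.add_sub_cancel, map_natCast]
  push_cast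
  ring

variable (k)

/-- The Lie subalgebra `W_{≥ 0}` of the Witt algebra. -/
noncomputable def wittZero : LieSubalgebra k (Witt k) :=
  { wittSpan k 0 with lie_mem' := fun hD hE => lie_mem_wittSpan hD hE }

/-- `W_{≥ n}` as a Lie ideal of `W_{≥ 0}`. -/
noncomputable def wittIdeal (n : ℕ) : LieIdeal k (wittZero k) :=
  { (wittSpan k n).comap (wittZero k).toSubmodule.subtype with
    lie_mem := fun {D _} hE => lie_mem_wittSpan D.2 hE }

/-- The finite-dimensional solvable Lie algebra `g_n = W_{≥ 0} / W_{≥ n}`. -/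
abbrev gLie (n : ℕ) : Type _ := wittZero k ⧸ wittIdeal k n

theorem e_mem (i : ℕ) : e k i ∈ wittZero k :=
  Submodule.subset_span ⟨i, Nat.zero_le i, rfl⟩

/-- `v_i = e_i + W_{≥ n}` in `g_n`; it vanishes when `i ≥ n`. -/
noncomputable def v (n i : ℕ) : gLie k n := LieSubmodule.Quotient.mk ⟨e k i, e_mem k i⟩

theorem v_eq_zero {n i : ℕ} (h : n ≤ i) : v k n i = 0 := by
  rw [v, LieSubmodule.Quotient.mk_eq_zero']
  exact Submodule.subset_span ⟨i, h, rfl⟩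

theorem lie_e (i j : ℕ) : ⁅e k i, e k j⁆ = ((j : k) - i) • e k (i + j) := by
  refine Polynomial.derivation_ext ?_
  rw [bracket_apply_X, Derivation.smul_apply, e, e, e, vf_apply_X, vf_apply_X, vf_apply_X,
    Polynomial.smul_eq_C_mul]
  simp only [derivative_X_pow, Nat.add_sub_cancel, map_natCast, map_sub]
  push_cast
  ring

theorem lie_v (n i j : ℕ) : ⁅v k n i, v k n j⁆ = ((j : k) - i) • v k n (i + j) := by
  have h : (⁅(⟨e k i, e_mem k i⟩ : wittZero k), (⟨e k j, e_mem k j⟩ : wittZero k)⁆) =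
      ((j : k) - i) • (⟨e k (i + j), e_mem k (i + j)⟩ : wittZero k) :=
    Subtype.ext (lie_e k i j)
  rw [v, v, ← LieSubmodule.Quotient.mk_bracket, h]
  rfl

/-! ### The first Weyl algebra -/

/-- The two generators of the first Weyl algebra. -/
inductive WeylGen : Type
  | t : WeylGen
  | d : WeylGen

/-- The defining relation `∂ t - t ∂ = 1`. -/
inductive WeylRel : FreeAlgebra k WeylGen → FreeAlgebra k WeylGen → Prop
  | comm : WeylRel
      (FreeAlgebra.ι k WeylGen.d * FreeAlgebra.ι k WeylGen.t -
        FreeAlgebra.ι k WeylGen.t * FreeAlgebra.ι k WeylGen.d) 1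

/-- The first Weyl algebra `A_1`, by generators `t, ∂` and the relation `∂ t - t ∂ = 1`. -/
def Weyl : Type _ := RingQuot (WeylRel k)

noncomputable instance : Ring (Weyl k) := inferInstanceAs (Ring (RingQuot (WeylRel k)))

noncomputable instance : Algebra k (Weyl k) := inferInstanceAs (Algebra k (RingQuot (WeylRel k)))

/-- The quotient map from the free algebra on `t, ∂` to the Weyl algebra. -/
noncomputable def weylMk : FreeAlgebra k WeylGen →ₐ[k] Weyl k := RingQuot.mkAlgHom k (WeylRel k)

/-- The generator `t` of the Weyl algebra. -/
noncomputable def wt : Weyl k := weylMk k (FreeAlgebra.ι k WeylGen.t)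

/-- The generator `∂` of the Weyl algebra. -/
noncomputable def wd : Weyl k := weylMk k (FreeAlgebra.ι k WeylGen.d)

theorem wd_mul_wt : wd k * wt k = wt k * wd k + 1 := by
  have h : weylMk k _ = weylMk k _ := RingQuot.mkAlgHom_rel k (WeylRel.comm (k := k))
  rw [map_sub, map_mul, map_mul, map_one] at h
  exact (sub_eq_iff_eq_add'.mp h)

theorem wd_mul_aeval (f : k[X]) :
    wd k * aeval (wt k) f = aeval (wt k) f * wd k + aeval (wt k) (derivative f) := by
  induction f using Polynomial.induction_on with
  | C a => simp [Algebra.commutes]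
  | add p q hp hq =>
    simp only [map_add, mul_add, add_mul, hp, hq]
    abel
  | monomial j a h =>
    have e1 : (C a * X ^ (j + 1) : k[X]) = (C a * X ^ j) * X := by ring
    rw [e1]
    generalize (C a * X ^ j : k[X]) = q at h ⊢
    rw [derivative_mul, derivative_X, mul_one, map_add, map_mul, map_mul, aeval_X, ← mul_assoc, h,
      add_mul, mul_assoc _ (wd k), wd_mul_wt]
    noncomm_ring

/-! ### The algebra `T_n` and the orbit homomorphism -/

/-- `T_n = A_1 ⊗ U(g_n)`. -/
abbrev T (n : ℕ) : Type _ := Weyl k ⊗[k] UniversalEnvelopingAlgebra k (gLie k n)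

/-- The image of `v_i` in `U(g_n)`. -/
noncomputable def uv (n i : ℕ) : UniversalEnvelopingAlgebra k (gLie k n) :=
  UniversalEnvelopingAlgebra.ι k (v k n i)

theorem uv_eq_zero {n i : ℕ} (h : n ≤ i) : uv k n i = 0 := by
  rw [uv, v_eq_zero k h, map_zero]

theorem uv_comm (n i j : ℕ) :
    uv k n i * uv k n j - uv k n j * uv k n i = ((j : k) - i) • uv k n (i + j) := by
  rw [uv, uv, ← LieRing.of_associative_ring_bracket, ← LieHom.map_lie, lie_v, uv, map_smul]

/-- The linear map
`f ∂ ↦ f ∂ + ∑_{i < n} (f^(i+1) / (i+1)!) v_i` from the Witt algebra to `T_n`;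
a derivation `D` of `k[t]` is `f ∂` with `f = D(t)`. -/
noncomputable def psiLin (n : ℕ) : Witt k →ₗ[k] T k n where
  toFun D :=
    (aeval (wt k) (D X) * wd k) ⊗ₜ[k] (1 : UniversalEnvelopingAlgebra k (gLie k n)) +
      ∑ i ∈ Finset.range n,
        aeval (wt k) (((Nat.factorial (i + 1) : k))⁻¹ • derivative^[i + 1] (D X)) ⊗ₜ[k] uv k n i
  map_add' D E := by
    simp only [Derivation.add_apply, map_add, add_mul, TensorProduct.add_tmul,
      iterate_map_add, smul_add, Finset.sum_add_distrib]
    abel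
  map_smul' c D := by
    simp only [Derivation.smul_apply, Polynomial.iterate_derivative_smul, map_smul,
      smul_mul_assoc, RingHom.id_apply, smul_add, Finset.smul_sum, TensorProduct.smul_tmul']
    simp only [smul_comm c]

theorem hasseDeriv_witt (m : ℕ) (f g : k[X]) :
    hasseDeriv (m + 1) (f * derivative g - derivative f * g) =
      f * derivative (hasseDeriv (m + 1) g) - derivative (hasseDeriv (m + 1) f) * g +
        ∑ p ∈ Finset.HasAntidiagonal.antidiagonal m,
          ((p.2 : k) - p.1) • (hasseDeriv (p.1 + 1) f * hasseDeriv (p.2 + 1) g) := by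
  have h1 : ∀ (j : ℕ) (q : k[X]), hasseDeriv j (derivative q) =
      ((j : k) + 1) • hasseDeriv (j + 1) q := by
    intro j q
    have := congrArg (fun L => L q) (hasseDeriv_comp (R := k) j 1)
    simp only [LinearMap.comp_apply, hasseDeriv_one, LinearMap.smul_apply] at this
    rw [this, ← Nat.cast_smul_eq_nsmul k]
    congr 1
    simp
  have h2 : ∀ (j : ℕ) (q : k[X]), derivative (hasseDeriv j q) =
      ((j : k) + 1) • hasseDeriv (j + 1) q := by
    intro j q
    have := congrArg (fun L => L q) (hasseDeriv_comp (R := k) 1 j)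
    simp only [LinearMap.comp_apply, hasseDeriv_one, LinearMap.smul_apply] at this
    rw [this, ← Nat.cast_smul_eq_nsmul k, Nat.add_comm 1 j]
    congr 1
    simp
  rw [map_sub, hasseDeriv_mul, hasseDeriv_mul, Finset.Nat.sum_antidiagonal_succ,
    Finset.Nat.sum_antidiagonal_succ']
  simp only [h1, h2, hasseDeriv_zero']
  have : ∀ p : ℕ × ℕ, ((p.2 : k) - p.1) • (hasseDeriv (p.1 + 1) f * hasseDeriv (p.2 + 1) g) =
      hasseDeriv (p.1 + 1) f * (((p.2 : k) + 1) • hasseDeriv (p.2 + 1) g) -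
        (((p.1 : k) + 1) • hasseDeriv (p.1 + 1) f) * hasseDeriv (p.2 + 1) g := by
    intro p
    simp only [Polynomial.smul_eq_C_mul, map_sub, map_add, map_one]
    ring
  simp only [this, Finset.sum_sub_distrib]
  ring

theorem sum_range_antidiagonal {M : Type*} [AddCommMonoid M] (n : ℕ) (F : ℕ → ℕ → M)
    (hF : ∀ i j, n ≤ i + j → F i j = 0) :
    ∑ m ∈ Finset.range n, ∑ p ∈ Finset.HasAntidiagonal.antidiagonal m, F p.1 p.2 =
      ∑ i ∈ Finset.range n, ∑ j ∈ Finset.range n, F i j := by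
  rw [← Finset.sum_product', Finset.sum_sigma']
  refine Finset.sum_of_injOn (fun x => x.2) ?_ ?_ ?_ ?_
  · rintro ⟨m, p⟩ h ⟨m', p'⟩ h' heq
    simp at h h' heq
    subst heq
    obtain rfl : m = m' := by omega
    rfl
  · rintro ⟨m, p⟩ h
    simp at h ⊢
    omega
  · rintro ⟨i, j⟩ _ h
    refine hF _ _ ?_
    by_contra hlt
    exact h ⟨⟨i + j, (i, j)⟩, by simp; omega, rfl⟩
  · intro _ _
    rfl

variable {k}

theorem psiLin_eq [CharZero k] (n : ℕ) (D : Witt k) :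
    psiLin k n D =
      (aeval (wt k) (D X) * wd k) ⊗ₜ[k] (1 : UniversalEnvelopingAlgebra k (gLie k n)) +
        ∑ i ∈ Finset.range n, aeval (wt k) (hasseDeriv (i + 1) (D X)) ⊗ₜ[k] uv k n i := by
  have h : ∀ (i : ℕ) (f : k[X]),
      ((Nat.factorial (i + 1) : k))⁻¹ • derivative^[i + 1] f = hasseDeriv (i + 1) f := by
    intro i f
    rw [← factorial_smul_hasseDeriv, LinearMap.smul_apply, ← Nat.cast_smul_eq_nsmul k, smul_smul,
      inv_mul_cancel₀ (Nat.cast_ne_zero.mpr (Nat.factorial_ne_zero _)), one_smul]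
  simp only [psiLin, LinearMap.coe_mk, AddHom.coe_mk, h]

theorem aeval_wt_comm (f g : k[X]) :
    aeval (wt k) f * aeval (wt k) g = aeval (wt k) g * aeval (wt k) f := by
  rw [← map_mul, ← map_mul, mul_comm]

theorem commutator_add_sum {A : Type*} [Ring A] (n : ℕ) (p q : A) (a b : ℕ → A) :
    (p + ∑ i ∈ Finset.range n, a i) * (q + ∑ i ∈ Finset.range n, b i) -
        (q + ∑ i ∈ Finset.range n, b i) * (p + ∑ i ∈ Finset.range n, a i) =
      (p * q - q * p) + (∑ i ∈ Finset.range n, (p * b i - b i * p) -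
        ∑ i ∈ Finset.range n, (q * a i - a i * q) +
        ∑ i ∈ Finset.range n, ∑ j ∈ Finset.range n, (a i * b j - b j * a i)) := by
  simp only [Finset.sum_sub_distrib, ← Finset.mul_sum, ← Finset.sum_mul]
  noncomm_ring

theorem psiLin_lie [CharZero k] (n : ℕ) (D E : Witt k) :
    psiLin k n ⁅D, E⁆ = psiLin k n D * psiLin k n E - psiLin k n E * psiLin k n D := by
  have c0 : ∀ (f : k[X]) (g : k[X]), (aeval (wt k) f * wd k) * aeval (wt k) g -
      aeval (wt k) g * (aeval (wt k) f * wd k) = aeval (wt k) (f * derivative g) := by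
    intro f g
    rw [mul_assoc, wd_mul_aeval, ← mul_assoc (aeval (wt k) g), aeval_wt_comm g f, map_mul]
    noncomm_ring
  have c1 : ∀ f g : k[X], ((aeval (wt k) f * wd k) ⊗ₜ[k] 1 : T k n) *
        ((aeval (wt k) g * wd k) ⊗ₜ[k] 1) -
        ((aeval (wt k) g * wd k) ⊗ₜ[k] 1) * ((aeval (wt k) f * wd k) ⊗ₜ[k] 1) =
      (aeval (wt k) (f * derivative g - derivative f * g) * wd k) ⊗ₜ[k] 1 := by
    intro f g
    rw [Algebra.TensorProduct.tmul_mul_tmul,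
      Algebra.TensorProduct.tmul_mul_tmul, mul_one, ← TensorProduct.sub_tmul]
    congr 1
    have h1 := c0 f g
    rw [← mul_assoc, ← mul_assoc, sub_eq_iff_eq_add.mp h1, mul_assoc _ _ (aeval (wt k) f),
      wd_mul_aeval, add_mul, map_sub, sub_mul, mul_add, add_mul, mul_comm (derivative f) g,
      map_mul _ g]
    noncomm_ring
  have c2 : ∀ (f g : k[X]) (j : ℕ), ((aeval (wt k) f * wd k) ⊗ₜ[k] 1 : T k n) *
        (aeval (wt k) g ⊗ₜ[k] uv k n j) -
        (aeval (wt k) g ⊗ₜ[k] uv k n j) * ((aeval (wt k) f * wd k) ⊗ₜ[k] 1) =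
      aeval (wt k) (f * derivative g) ⊗ₜ[k] uv k n j := by
    intro f g j
    rw [Algebra.TensorProduct.tmul_mul_tmul,
      Algebra.TensorProduct.tmul_mul_tmul, mul_one, one_mul, ← TensorProduct.sub_tmul, c0]
  have c3 : ∀ (f g : k[X]) (i j : ℕ), (aeval (wt k) f ⊗ₜ[k] uv k n i : T k n) *
        (aeval (wt k) g ⊗ₜ[k] uv k n j) -
        (aeval (wt k) g ⊗ₜ[k] uv k n j) * (aeval (wt k) f ⊗ₜ[k] uv k n i) =
      aeval (wt k) (((j : k) - i) • (f * g)) ⊗ₜ[k] uv k n (i + j) := by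
    intro f g i j
    rw [Algebra.TensorProduct.tmul_mul_tmul,
      Algebra.TensorProduct.tmul_mul_tmul, aeval_wt_comm g f, ← TensorProduct.tmul_sub, uv_comm,
      map_smul, map_mul, TensorProduct.tmul_smul, TensorProduct.smul_tmul']
  have c4 : ∀ m ∈ Finset.range n, aeval (wt k) (∑ p ∈ Finset.HasAntidiagonal.antidiagonal m,
        ((p.2 : k) - p.1) • (hasseDeriv (p.1 + 1) (D X) * hasseDeriv (p.2 + 1) (E X))) ⊗ₜ[k]
          uv k n m =
      ∑ p ∈ Finset.HasAntidiagonal.antidiagonal m, aeval (wt k) (((p.2 : k) - p.1) •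
        (hasseDeriv (p.1 + 1) (D X) * hasseDeriv (p.2 + 1) (E X))) ⊗ₜ[k] uv k n (p.1 + p.2) := by
    intro m _
    rw [map_sum, TensorProduct.sum_tmul]
    exact Finset.sum_congr rfl fun p hp => by
      rw [Finset.HasAntidiagonal.mem_antidiagonal.mp hp]
  rw [psiLin_eq, psiLin_eq, psiLin_eq, bracket_apply_X]
  simp only [hasseDeriv_witt, map_add, TensorProduct.add_tmul, Finset.sum_add_distrib]
  rw [Finset.sum_congr rfl c4]
  rw [sum_range_antidiagonal n (fun i j => aeval (wt k) (((j : k) - i) •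
    (hasseDeriv (i + 1) (D X) * hasseDeriv (j + 1) (E X))) ⊗ₜ[k] uv k n (i + j))
    (fun i j h => by rw [uv_eq_zero k h, TensorProduct.tmul_zero])]
  rw [commutator_add_sum, c1]
  simp only [c2, c3, map_sub, Finset.sum_sub_distrib, sub_mul, TensorProduct.sub_tmul,
    mul_comm (derivative _) (E X)]

variable (k)

/-- The `n`-th orbit homomorphism `Ψ_n : U(W_{≥ -1}) → T_n`, the algebra homomorphism with
`f ∂ ↦ f ∂ + ∑_{i < n} (f^(i+1) / (i+1)!) v_i`. -/
noncomputable def orbitHom [CharZero k] (n : ℕ) :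
    UniversalEnvelopingAlgebra k (Witt k) →ₐ[k] T k n :=
  UniversalEnvelopingAlgebra.lift k
    { psiLin k n with map_lie' := fun {D E} =>
        (psiLin_lie n D E).trans (LieRing.of_associative_ring_bracket _ _).symm }

theorem orbitHom_ι [CharZero k] (n : ℕ) (D : Witt k) :
    orbitHom k n (UniversalEnvelopingAlgebra.ι k D) = psiLin k n D :=
  UniversalEnvelopingAlgebra.lift_ι_apply k _ D

/-- The image `B_n` of the `n`-th orbit homomorphism. -/
noncomputable def B [CharZero k] (n : ℕ) : Subalgebra k (T k n) := (orbitHom k n).range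

/-! ### The degree grading -/

/-- The ordered monomial `t^a ∂^b v_0^(m_0) ⋯ v_(n-1)^(m_(n-1))` of `T_n`. -/
noncomputable def tMon (n a b : ℕ) (m : Fin n → ℕ) : T k n :=
  (wt k ^ a * wd k ^ b) ⊗ₜ[k] (List.ofFn fun i : Fin n => uv k n i ^ m i).prod

/-- The degree `d` piece of `T_n`: the span of the ordered monomials with
`a - b + ∑ i m_i = d`. -/
noncomputable def tDeg (n : ℕ) (d : ℤ) : Submodule k (T k n) :=
  Submodule.span k {x | ∃ (a b : ℕ) (m : Fin n → ℕ),
    (a : ℤ) - b + ∑ i : Fin n, (i : ℤ) * m i = d ∧ x = tMon k n a b m}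

end

/-! ### Ordered monomials and words -/

section Straightening

variable {k A : Type*} [Field k] [Ring A] [Algebra k A] {N : ℕ}

/-- The span of the words of length `< L` and degree `d` in letters `x i` of degree `deg i`. -/
def wordSpan (k : Type*) [Field k] [Algebra k A] (x : Fin N → A) (deg : Fin N → ℤ) (L : ℕ)
    (d : ℤ) : Submodule k A :=
  Submodule.span k {y | ∃ w : List (Fin N), w.length < L ∧ (w.map deg).sum = d ∧
    y = (w.map x).prod}

theorem word_mem (x : Fin N → A) (deg : Fin N → ℤ) {L : ℕ} {d : ℤ} (w : List (Fin N))
    (hL : w.length < L) (hd : (w.map deg).sum = d) : (w.map x).prod ∈ wordSpan k x deg L d :=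
  Submodule.subset_span ⟨w, hL, hd, rfl⟩

theorem wordSpan_mono (x : Fin N → A) (deg : Fin N → ℤ) {L L' : ℕ} (h : L ≤ L') (d : ℤ) :
    wordSpan k x deg L d ≤ wordSpan k x deg L' d := by
  refine Submodule.span_le.mpr ?_
  rintro y ⟨w, hL, hd, rfl⟩
  exact word_mem x deg w (hL.trans_le h) hd

theorem letter_mul_mem (x : Fin N → A) (deg : Fin N → ℤ) {L : ℕ} {d : ℤ} (i : Fin N) {y : A}
    (hy : y ∈ wordSpan k x deg L d) : x i * y ∈ wordSpan k x deg (L + 1) (deg i + d) := by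
  induction hy using Submodule.span_induction with
  | mem y h =>
    obtain ⟨w, hL, hd, rfl⟩ := h
    have := word_mem (k := k) x deg (L := L + 1) (d := deg i + d) (i :: w) (by simpa using hL)
      (by simp [hd])
    simpa using this
  | zero => simp
  | add y z _ _ hy hz => rw [mul_add]; exact add_mem hy hz
  | smul c y _ hy => rw [mul_smul_comm]; exact Submodule.smul_mem _ _ hy

theorem mul_word_mem (x : Fin N → A) (deg : Fin N → ℤ) {L : ℕ} {d : ℤ} (w : List (Fin N)) {y : A}
    (hy : y ∈ wordSpan k x deg L d) :
    y * (w.map x).prod ∈ wordSpan k x deg (L + w.length) (d + (w.map deg).sum) := by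
  induction hy using Submodule.span_induction with
  | mem y h =>
    obtain ⟨u, hL, hd, rfl⟩ := h
    have := word_mem (k := k) x deg (L := L + w.length) (d := d + (w.map deg).sum) (u ++ w)
      (by simpa using hL) (by simp [hd])
    simpa using this
  | zero => simp
  | add y z _ _ hy hz => rw [add_mul]; exact add_mem hy hz
  | smul c y _ hy => rw [smul_mul_assoc]; exact Submodule.smul_mem _ _ hy

theorem perm_sub_mem (x : Fin N → A) (deg : Fin N → ℤ)
    (hx : ∀ i j, x i * x j - x j * x i ∈ wordSpan k x deg 2 (deg i + deg j))
    {w w' : List (Fin N)} (h : w.Perm w') :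
    (w.map x).prod - (w'.map x).prod ∈ wordSpan k x deg w.length (w.map deg).sum := by
  induction h with
  | nil => simp
  | cons a _ ih =>
    have := letter_mul_mem x deg a ih
    simpa [mul_sub] using this
  | swap a b l =>
    have := mul_word_mem x deg l (hx b a)
    simpa [sub_mul, mul_assoc, add_assoc, add_comm, add_left_comm] using this
  | trans h1 h2 ih1 ih2 =>
    rw [← h1.length_eq, ← (h1.map deg).sum_eq] at ih2
    simpa using add_mem ih1 ih2

/-- The word `0 ⋯ 0 1 ⋯ 1 ⋯` in which the letter `i` occurs `c i` times. -/
def sortedWord (c : Fin N → ℕ) : List (Fin N) :=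
  (List.finRange N).flatMap fun i => List.replicate (c i) i

theorem sortedWord_prod (x : Fin N → A) (c : Fin N → ℕ) :
    ((sortedWord c).map x).prod = (List.ofFn fun i => x i ^ c i).prod := by
  rw [sortedWord, List.ofFn_eq_map]
  generalize List.finRange N = l
  induction l with
  | nil => simp
  | cons i l ih => simp [ih]

theorem sortedWord_deg (deg : Fin N → ℤ) (c : Fin N → ℕ) :
    ((sortedWord c).map deg).sum = ∑ i, deg i * c i := by
  rw [← List.sum_ofFn, sortedWord, List.ofFn_eq_map]
  generalize List.finRange N = l
  induction l with
  | nil => simp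
  | cons i l ih => simp [ih, mul_comm]

theorem perm_sortedWord (w : List (Fin N)) : w.Perm (sortedWord fun i => w.count i) := by
  rw [List.perm_iff_count]
  intro a
  rw [sortedWord, List.count_flatMap]
  have h : (List.count a ∘ fun i => List.replicate (w.count i) i) =
      fun i => if i = a then w.count a else 0 := by
    funext i
    by_cases h : i = a <;> simp [List.count_replicate, h]
  rw [h, ← List.ofFn_eq_map, List.sum_ofFn]
  simp

theorem word_mem_sorted (x : Fin N → A) (deg : Fin N → ℤ)
    (hx : ∀ i j, x i * x j - x j * x i ∈ wordSpan k x deg 2 (deg i + deg j)) (L : ℕ) (d : ℤ) :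
    wordSpan k x deg L d ≤ Submodule.span k {y | ∃ c : Fin N → ℕ, ∑ i, deg i * c i = d ∧
      y = (List.ofFn fun i => x i ^ c i).prod} := by
  induction L with
  | zero =>
    refine Submodule.span_le.mpr ?_
    rintro y ⟨w, hL, -, -⟩
    exact absurd hL (Nat.not_lt_zero _)
  | succ L ih =>
    refine Submodule.span_le.mpr ?_
    rintro y ⟨w, hL, rfl, rfl⟩
    have hp := perm_sortedWord w
    have h1 := ih (wordSpan_mono x deg (Nat.lt_succ_iff.mp hL) _ (perm_sub_mem x deg hx hp))
    rw [← sub_add_cancel (w.map x).prod ((sortedWord fun i => w.count i).map x).prod]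
    refine add_mem h1 (Submodule.subset_span ⟨fun i => w.count i, ?_, sortedWord_prod x _⟩)
    rw [← sortedWord_deg, (hp.map deg).sum_eq]

end Straightening

section

variable (k : Type*) [Field k]

/-- The generators `t, ∂, v_0, …, v_(n-1)` of `T_n`. -/
noncomputable def tGen (n : ℕ) : Fin (n + 2) → T k n :=
  Fin.cons (wt k ⊗ₜ 1) (Fin.cons (wd k ⊗ₜ 1) fun i : Fin n => 1 ⊗ₜ uv k n i)

/-- The degrees `1, -1, 0, …, n - 1` of the generators of `T_n`. -/
def tGenDeg (n : ℕ) : Fin (n + 2) → ℤ :=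
  Fin.cons 1 (Fin.cons (-1) fun i : Fin n => (i : ℤ))

theorem tGen_comm (n : ℕ) (i j : Fin (n + 2)) :
    tGen k n i * tGen k n j - tGen k n j * tGen k n i ∈
      wordSpan k (tGen k n) (tGenDeg n) 2 (tGenDeg n i + tGenDeg n j) := by
  have h1 : (1 : T k n) ∈ wordSpan k (tGen k n) (tGenDeg n) 2 0 := by
    simpa using word_mem (k := k) (tGen k n) (tGenDeg n) (L := 2) (d := 0) [] (by simp) (by simp)
  refine Fin.cases ?_ (fun i => Fin.cases ?_ (fun i => ?_) i) i <;>
  refine Fin.cases ?_ (fun j => Fin.cases ?_ (fun j => ?_) j) j <;>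
  simp only [tGen, tGenDeg, Fin.cons_zero, Fin.cons_succ, Algebra.TensorProduct.tmul_mul_tmul,
    one_mul, mul_one, sub_self, zero_mem]
  · rw [wd_mul_wt, ← TensorProduct.sub_tmul, sub_add_cancel_left, TensorProduct.neg_tmul]
    exact neg_mem h1
  · rw [wd_mul_wt, ← TensorProduct.sub_tmul, add_sub_cancel_left]
    exact h1
  · rw [← TensorProduct.tmul_sub, uv_comm, TensorProduct.tmul_smul]
    refine Submodule.smul_mem _ _ ?_
    by_cases h : (i : ℕ) + j < n
    · have := word_mem (k := k) (tGen k n) (tGenDeg n) (L := 2) (d := (i : ℤ) + j)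
        [(⟨i + j, h⟩ : Fin n).succ.succ] (by simp)
        (by simp only [tGenDeg, List.map_cons, List.map_nil, List.sum_singleton, Fin.cons_succ]
            push_cast
            rfl)
      simpa only [tGen, tGenDeg, List.map_cons, List.map_nil, List.prod_singleton,
        Fin.cons_succ] using this
    · rw [uv_eq_zero k (not_lt.mp h), TensorProduct.tmul_zero]
      exact zero_mem _

theorem tMon_eq (n a b : ℕ) (m : Fin n → ℕ) :
    tMon k n a b m = (List.ofFn fun i => tGen k n i ^
      (Fin.cons a (Fin.cons b m : Fin (n + 1) → ℕ) : Fin (n + 2) → ℕ) i).prod := by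
  have h : ∀ l : List (Fin n), (1 : Weyl k) ⊗ₜ[k] (l.map fun i : Fin n => uv k n i ^ m i).prod =
      (l.map fun i : Fin n => ((1 : Weyl k) ⊗ₜ[k] uv k n i) ^ m i).prod := by
    intro l
    induction l with
    | nil => simp [Algebra.TensorProduct.one_def]
    | cons i l ih =>
      rw [List.map_cons, List.map_cons, List.prod_cons, List.prod_cons, ← ih,
        Algebra.TensorProduct.tmul_pow, Algebra.TensorProduct.tmul_mul_tmul, one_pow, one_mul]
  rw [List.ofFn_succ, List.ofFn_succ]
  simp only [tGen, Fin.cons_zero, Fin.cons_succ, List.prod_cons]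
  rw [List.ofFn_eq_map, ← h, ← List.ofFn_eq_map, tMon]
  simp [Algebra.TensorProduct.tmul_pow, Algebra.TensorProduct.tmul_mul_tmul]

/-- The degree `d` piece of `T_n` contains all products, in any order, of the homogeneous
generators `t, ∂, v_i` that have total degree `d`. -/
theorem word_mem_tDeg (n : ℕ) (w : List (Fin (n + 2))) :
    (w.map (tGen k n)).prod ∈ tDeg k n (w.map (tGenDeg n)).sum := by
  have h := word_mem_sorted (k := k) (tGen k n) (tGenDeg n) (tGen_comm k n) _ _
    (word_mem _ _ w (Nat.lt_succ_self _) rfl)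
  refine Submodule.span_mono ?_ h
  rintro y ⟨c, hc, rfl⟩
  refine ⟨c 0, c 1, fun i => c i.succ.succ, ?_, ?_⟩
  · rw [← hc, Fin.sum_univ_succ, Fin.sum_univ_succ]
    simp [tGenDeg]
    ring
  · rw [tMon_eq]
    congr 3
    funext i
    congr 1
    refine Fin.cases rfl (fun i => Fin.cases rfl (fun i => rfl) i) i

/-- A monomial of degree `d` is a word of degree `d` in the generators. -/
theorem tMon_eq_word (n a b : ℕ) (m : Fin n → ℕ) : ∃ w : List (Fin (n + 2)),
    (w.map (tGenDeg n)).sum = (a : ℤ) - b + ∑ i : Fin n, (i : ℤ) * m i ∧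
      tMon k n a b m = (w.map (tGen k n)).prod := by
  refine ⟨sortedWord (Fin.cons a (Fin.cons b m : Fin (n + 1) → ℕ)), ?_, ?_⟩
  · rw [sortedWord_deg, Fin.sum_univ_succ, Fin.sum_univ_succ]
    simp [tGenDeg]
    ring
  · exact (tMon_eq k n a b m).trans (sortedWord_prod _ _).symm

instance tDeg_gradedMonoid (n : ℕ) : SetLike.GradedMonoid (tDeg k n) where
  one_mem := by simpa using word_mem_tDeg k n []
  mul_mem := by
    intro d d' x y hx hy
    have hle : tDeg k n d * tDeg k n d' ≤ tDeg k n (d + d') := by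
      rw [tDeg, tDeg, Submodule.span_mul_span]
      refine Submodule.span_le.mpr ?_
      rintro _ ⟨_, ⟨a, b, m, rfl, rfl⟩, _, ⟨a', b', m', rfl, rfl⟩, rfl⟩
      obtain ⟨w, hw, hw'⟩ := tMon_eq_word k n a b m
      obtain ⟨u, hu, hu'⟩ := tMon_eq_word k n a' b' m'
      rw [← hw, ← hu, hw', hu']
      simpa using word_mem_tDeg k n (w ++ u)
    exact hle (Submodule.mul_mem_mul hx hy)

/-- The degree zero subalgebra `(T_n)_0` of `T_n`. -/
noncomputable def TZero (n : ℕ) : Subalgebra k (T k n) := SetLike.GradeZero.subalgebra (tDeg k n)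

/-- The subring `(B_n)_0 = B_n ∩ (T_n)_0` of degree zero elements of `B_n`. -/
noncomputable def BZero [CharZero k] (n : ℕ) : Subalgebra k (T k n) := B k n ⊓ TZero k n

end

end OrbitHom

/-!
The proof compares `(B_n)_0` with a commutative algebra of symbols, in the manner of a filtered ring
with Noetherian associated graded ring.

**Symbols.** The algebra `g_n` acts by vector fields on the coefficients `u_0, …, u_(n-1)` of a
substitution `φ(s) = u_0 s + ⋯ + u_(n-1) s ^ n` modulo `s ^ (n + 1)`, the class of `f ∂` acting by
`φ ↦ f(φ)` (`flow_lie`). So `T_n` acts by differential operators in `t` and the `u_j`. Conjugating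
by the formal exponential `exp ((t + ∑ u_j η_j) X)` turns the order of an operator into the degree
in `X` by which it raises polynomials over `k[t, u, η]`, and its principal symbol into the factor by
which it multiplies top coefficients (`HasSymbol`). At the point `φ = s` the symbols of
`t, ∂, v_i` are `t, 1, η_i`. Hence the symbols of distinct ordered monomials of the same order and
of degree zero are linearly independent, and every nonzero element of `(T_n)_0` has a nonzero
symbol (`exists_symbol`). Symbols multiply in a domain, so `(B_n)_0` is a domain. This replaces the
Poincaré–Birkhoff–Witt theorem for `g_n`.

**Finiteness.** Placed in its degree in `X`, the symbol of an element of `(T_n)_0` is a polynomial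
in the symbols `x` of `t ∂` and `y_i` of `∂ ^ i v_i`. The symbol of `Ψ_n(e_{-1} ^ m e_m)`, which
lies in `(B_n)_0`, is the value `p_(m+1)` on `s ^ (m + 1)` of the functional
`L(f) = f(x) + ∑ y_i f^(i+1)(x) / (i+1)!`. This `L` vanishes on `(s - x) ^ (n + 1)`, and takes the
value `y_i` on `(s - x) ^ (i + 1)`; since `L(1) = 1`, the first identity is an integral equation for
`x` over `C = k[p_1, …, p_(n+1)]`, and the second puts `y_i` into `C[x]` (`isIntegral_of_moment`,
`mem_adjoin_of_moment`). So all symbols lie in `C[x]`, a finite module over the Noetherian ring `C`,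
and `C` consists of sums of symbols of elements of `(B_n)_0`.

**Conclusion.** A left or right ideal of `(B_n)_0` has an associated graded `C`-submodule of `C[x]`,
and this assignment is strictly monotone (`SymbolCalculus.le_of_gr_le`). The ascending chain
condition for `C[x]` therefore gives that for one-sided ideals of `(B_n)_0`.
-/

/-! ### Rings with a symbol calculus -/

namespace OrbitHom

/-- A relation `rel m b s`, read "`b` has order at most `m`, and `s` is the class of `b` in degree
`m`", which behaves like the symbol of a filtered ring `B` with associated graded ring inside
the commutative ring `R[X]`, the class `s` in degree `m` being placed at `s X ^ m`. The submodule
`S` of `R[X]` contains all these classes. -/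
structure SymbolCalculus {B R : Type*} [Ring B] [CommRing R] (S : AddSubgroup R[X])
    (rel : ℕ → B → R → Prop) : Prop where
  zero : ∀ m, rel m 0 0
  one : rel 0 1 1
  add : ∀ {m b c s t}, rel m b s → rel m c t → rel m (b + c) (s + t)
  neg : ∀ {m b s}, rel m b s → rel m (-b) (-s)
  mul : ∀ {m l b c s t}, rel m b s → rel l c t → rel (m + l) (b * c) (s * t)
  raise : ∀ {m l b s}, rel m b s → m < l → rel l b 0
  unique : ∀ {m b s t}, rel m b s → rel m b t → s = t
  exists_ne : ∀ {b}, b ≠ 0 → ∃ m s, s ≠ 0 ∧ rel m b s ∧ monomial m s ∈ S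

namespace SymbolCalculus

variable {B R : Type*} [Ring B] [CommRing R] {S : AddSubgroup R[X]}
  {rel : ℕ → B → R → Prop}

theorem op (h : SymbolCalculus S rel) :
    SymbolCalculus S fun m (b : Bᵐᵒᵖ) s => rel m b.unop s where
  zero := h.zero
  one := h.one
  add := h.add
  neg := h.neg
  mul {m l b c s t} hb hc := by
    rw [add_comm m l, mul_comm s t]
    exact h.mul hc hb
  raise := h.raise
  unique := h.unique
  exists_ne hb := h.exists_ne (by simpa using hb)

theorem monomial_mem (h : SymbolCalculus S rel) {m : ℕ} {b : B} {s : R} (hb : rel m b s) :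
    monomial m s ∈ S := by
  by_cases h0 : b = 0
  · subst h0
    rw [h.unique hb (h.zero m), monomial_zero_right]
    exact zero_mem _
  obtain ⟨l, r, hr, hbr, hS⟩ := h.exists_ne h0
  rcases lt_trichotomy m l with hml | rfl | hml
  · exact absurd (h.unique hbr (h.raise hb hml)) hr
  · rwa [h.unique hb hbr]
  · rw [h.unique hb (h.raise hbr hml), monomial_zero_right]
    exact zero_mem _

theorem sum (h : SymbolCalculus S rel) {ι : Type*} (F : Finset ι) {m : ℕ} {b : ι → B} {s : ι → R}
    (hb : ∀ i ∈ F, rel m (b i) (s i)) : rel m (∑ i ∈ F, b i) (∑ i ∈ F, s i) := by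
  classical
  induction F using Finset.induction_on with
  | empty => simpa using h.zero m
  | insert i F hi ih =>
    rw [Finset.sum_insert hi, Finset.sum_insert hi]
    exact h.add (hb i (Finset.mem_insert_self _ _))
      (ih fun j hj => hb j (Finset.mem_insert_of_mem hj))

theorem isDomain [IsDomain R] (h : SymbolCalculus S rel) : IsDomain B := by
  have hnt : Nontrivial B := by
    refine ⟨⟨0, 1, fun h01 => ?_⟩⟩
    have h1 := h.one
    rw [← h01] at h1
    exact zero_ne_one (h.unique (h.zero 0) h1)
  have hnz : NoZeroDivisors B := by
    refine ⟨fun {a b} hab => ?_⟩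
    by_contra! hne
    obtain ⟨m, s, hs, has, -⟩ := h.exists_ne hne.1
    obtain ⟨l, t, ht, hbt, -⟩ := h.exists_ne hne.2
    have hst := h.mul has hbt
    rw [hab] at hst
    exact mul_ne_zero hs ht (h.unique hst (h.zero _))
  exact NoZeroDivisors.to_isDomain B

/-- The associated graded group of an additive subgroup `I` of `B`: the polynomials all of whose
coefficients are symbols of elements of `I` in the corresponding degree. -/
def gr (h : SymbolCalculus S rel) (I : AddSubgroup B) : AddSubgroup R[X] where
  carrier := {r | ∀ m, ∃ b ∈ I, rel m b (r.coeff m)}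
  zero_mem' m := ⟨0, zero_mem _, by simpa using h.zero m⟩
  add_mem' hr hs m := by
    obtain ⟨b, hb, hbr⟩ := hr m
    obtain ⟨c, hc, hcs⟩ := hs m
    exact ⟨b + c, add_mem hb hc, by simpa using h.add hbr hcs⟩
  neg_mem' hr m := by
    obtain ⟨b, hb, hbr⟩ := hr m
    exact ⟨-b, neg_mem hb, by simpa using h.neg hbr⟩

theorem gr_le (h : SymbolCalculus S rel) (I : AddSubgroup B) : h.gr I ≤ S := by
  intro r hr
  rw [r.as_sum_support]
  refine sum_mem fun m _ => ?_
  obtain ⟨b, -, hb⟩ := hr m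
  exact h.monomial_mem hb

theorem monomial_mem_gr (h : SymbolCalculus S rel) {I : AddSubgroup B} {m : ℕ} {b : B} {s : R}
    (hI : b ∈ I) (hb : rel m b s) : monomial m s ∈ h.gr I := by
  intro l
  by_cases hl : m = l
  · subst hl
    exact ⟨b, hI, by simpa using hb⟩
  · exact ⟨0, zero_mem _, by simpa [coeff_monomial, hl] using h.zero l⟩

theorem gr_mono (h : SymbolCalculus S rel) {I J : AddSubgroup B} (hIJ : I ≤ J) :
    h.gr I ≤ h.gr J := fun _ hr m =>
  let ⟨b, hb, hbr⟩ := hr m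
  ⟨b, hIJ hb, hbr⟩

/-- Two nested subgroups with the same associated graded group are equal: a class of an element of
the larger one can be cancelled by an element of the smaller one, which lowers the order. -/
theorem le_of_gr_le (h : SymbolCalculus S rel) {I J : AddSubgroup B} (hIJ : I ≤ J)
    (hgr : h.gr J ≤ h.gr I) : J ≤ I := by
  have key : ∀ (m : ℕ) (b : B), b ∈ J → ∀ s, rel m b s → b ∈ I := by
    intro m
    induction m using Nat.strong_induction_on with
    | _ m ih =>
    intro b hb s hs
    obtain ⟨a, ha, has⟩ := hgr (h.monomial_mem_gr hb hs) m
    rw [coeff_monomial_same] at has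
    have hd : rel m (b + -a) 0 := by simpa using h.add hs (h.neg has)
    have hmem : b + -a ∈ I := by
      by_cases h0 : b + -a = 0
      · rw [h0]
        exact zero_mem _
      obtain ⟨l, r, hr, hl, -⟩ := h.exists_ne h0
      have hlm : l < m := by
        by_contra hge
        rcases (not_lt.mp hge).lt_or_eq with hlt | rfl
        · exact hr (h.unique hl (h.raise hd hlt))
        · exact hr (h.unique hl hd)
      exact ih l hlm _ (add_mem hb (neg_mem (hIJ ha))) r hl
    simpa using add_mem hmem ha
  intro b hb
  by_cases h0 : b = 0
  · rw [h0]
    exact zero_mem _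
  obtain ⟨m, s, -, hs, -⟩ := h.exists_ne h0
  exact key m b hb s hs

theorem mul_mem_gr (h : SymbolCalculus S rel) (I : Ideal B) {c r : R[X]} (hc : c ∈ h.gr ⊤)
    (hr : r ∈ h.gr I.toAddSubgroup) : c * r ∈ h.gr I.toAddSubgroup := by
  intro m
  choose b _ hbc using hc
  choose a ha har using hr
  refine ⟨∑ p ∈ Finset.HasAntidiagonal.antidiagonal m, b p.1 * a p.2,
    sum_mem fun p _ => I.mul_mem_left _ (ha p.2), ?_⟩
  rw [coeff_mul]
  refine h.sum _ fun p hp => ?_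
  rw [← Finset.HasAntidiagonal.mem_antidiagonal.mp hp]
  exact h.mul (hbc _) (har _)

/-- If the symbols of `B` lie in a Noetherian module over a commutative ring that acts on `R[X]`
through the associated graded ring of `B`, then `B` is left Noetherian: passage to associated
graded modules is strictly monotone on left ideals. -/
theorem isNoetherianRing (h : SymbolCalculus S rel) {A : Type*} [CommRing A] [Algebra A R[X]]
    (hA : ∀ a : A, algebraMap A R[X] a ∈ h.gr ⊤) (M : Submodule A R[X]) [IsNoetherian A M]
    (hS : S ≤ M.toAddSubgroup) : IsNoetherianRing B := by
  let G : Ideal B → Submodule A M := fun I =>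
    Submodule.comap M.subtype
      { (h.gr I.toAddSubgroup) with
        smul_mem' := fun a r hr => by
          rw [Algebra.smul_def]
          exact h.mul_mem_gr I (hA a) hr }
  have hG : StrictMono G := by
    intro I J hIJ
    refine lt_of_le_not_ge (fun x hx => ?_) fun hle => ?_
    · exact h.gr_mono (J := J.toAddSubgroup) (fun y hy => hIJ.le hy) hx
    · refine hIJ.not_ge ?_
      refine h.le_of_gr_le (I := I.toAddSubgroup) (J := J.toAddSubgroup) (fun y hy => hIJ.le hy) ?_
      intro r hr
      exact hle (x := ⟨r, hS (h.gr_le _ hr)⟩) hr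
  have := (isNoetherian_iff' (R := A) (M := M)).mp inferInstance
  exact isNoetherianRing_iff.mpr (isNoetherian_iff'.mpr hG.wellFoundedGT)

end SymbolCalculus

end OrbitHom

/-! ### Operators on polynomials and their principal symbols -/

namespace OrbitHom

section Operators

attribute [local instance 100] LieRing.ofAssociativeRing

variable {k R : Type*} [CommRing k] [CommRing R] [Algebra k R]

/-- The derivation of `R[X]` that applies a derivation `D` of `R` to each coefficient. -/
noncomputable def coeffDeriv (D : Derivation k R R) : Derivation k R[X] R[X] :=
  PolynomialModule.equivPolynomialSelf.toLinearMap.compDer D.mapCoeffs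

theorem coeff_coeffDeriv (D : Derivation k R R) (f : R[X]) (i : ℕ) :
    (coeffDeriv D f).coeff i = D (f.coeff i) := rfl

theorem coeffDeriv_C (D : Derivation k R R) (r : R) : coeffDeriv D (C r) = C (D r) := by
  ext i
  rw [coeff_coeffDeriv, coeff_C, coeff_C]
  split_ifs <;> simp

theorem coeffDeriv_X (D : Derivation k R R) : coeffDeriv D X = 0 := by
  ext i
  rw [coeff_coeffDeriv, coeff_X, coeff_zero]
  split_ifs <;> simp

theorem natDegree_coeffDeriv_le (D : Derivation k R R) (f : R[X]) :
    (coeffDeriv D f).natDegree ≤ f.natDegree :=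
  natDegree_le_iff_coeff_eq_zero.mpr fun i hi => by
    rw [coeff_coeffDeriv, coeff_eq_zero_of_natDegree_lt hi, map_zero]

/-- The conjugate of `D` by the formal exponential `exp (w X)`, that is, the operator
`f ↦ D f + D(w) X f` on `R[X]`. -/
noncomputable def twist (w : R) : Derivation k R R →ₗ[k] Module.End k R[X] where
  toFun D := (coeffDeriv D).toLinearMap + LinearMap.mulLeft k (C (D w) * X)
  map_add' D E := by
    ext1 f
    ext i
    simp [coeff_coeffDeriv, add_mul, mul_assoc]
    ring
  map_smul' c D := by
    ext1 f
    ext i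
    simp [coeff_coeffDeriv, ← smul_C, mul_assoc]

theorem twist_apply (w : R) (D : Derivation k R R) (f : R[X]) :
    twist w D f = coeffDeriv D f + C (D w) * X * f := rfl

theorem twist_lie (w : R) (D E : Derivation k R R) :
    twist w ⁅D, E⁆ = twist w D * twist w E - twist w E * twist w D := by
  have h : ∀ f, coeffDeriv ⁅D, E⁆ f =
      coeffDeriv D (coeffDeriv E f) - coeffDeriv E (coeffDeriv D f) := by
    intro f
    ext i
    simp only [coeff_coeffDeriv, coeff_sub, Derivation.commutator_apply]
  ext1 f
  simp only [LinearMap.sub_apply, Module.End.mul_apply, twist_apply, map_add, Derivation.leibniz,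
    coeffDeriv_C, coeffDeriv_X, smul_eq_mul, h, Derivation.commutator_apply, C_sub]
  ring

/-- `P` has order at most `m` in `X`, with symbol `s`: it maps polynomials of degree at most `d` to
polynomials of degree at most `m + d`, and multiplies the top coefficient by `s`. -/
def HasSymbol (m : ℕ) (P : Module.End k R[X]) (s : R) : Prop :=
  ∀ (d : ℕ) (f : R[X]), f.natDegree ≤ d →
    (P f).natDegree ≤ m + d ∧ (P f).coeff (m + d) = s * f.coeff d

namespace HasSymbol

variable {m l : ℕ} {P Q : Module.End k R[X]} {s t : R}

theorem zero (m : ℕ) : HasSymbol m (0 : Module.End k R[X]) 0 := by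
  intro d f _
  simp

theorem one : HasSymbol 0 (1 : Module.End k R[X]) 1 := by
  intro d f hf
  simpa using hf

theorem add (hP : HasSymbol m P s) (hQ : HasSymbol m Q t) : HasSymbol m (P + Q) (s + t) := by
  intro d f hf
  refine ⟨natDegree_add_le_of_degree_le (hP d f hf).1 (hQ d f hf).1, ?_⟩
  rw [LinearMap.add_apply, coeff_add, (hP d f hf).2, (hQ d f hf).2, add_mul]

theorem mul (hP : HasSymbol m P s) (hQ : HasSymbol l Q t) :
    HasSymbol (m + l) (P * Q) (s * t) := by
  intro d f hf
  have h := hP (l + d) (Q f) (hQ d f hf).1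
  rw [Module.End.mul_apply, add_assoc, mul_assoc, ← (hQ d f hf).2]
  exact h

theorem raise (hP : HasSymbol m P s) (h : m < l) : HasSymbol l P 0 := by
  intro d f hf
  have h1 := (hP d f hf).1
  refine ⟨by omega, ?_⟩
  rw [zero_mul]
  exact coeff_eq_zero_of_natDegree_lt (by omega)

theorem unique (hP : HasSymbol m P s) (hP' : HasSymbol m P t) : s = t := by
  have h := (hP 0 1 (by simp)).2
  rw [(hP' 0 1 (by simp)).2] at h
  simpa using h.symm

theorem smul (c : k) (hP : HasSymbol m P s) : HasSymbol m (c • P) (c • s) := by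
  intro d f hf
  refine ⟨(natDegree_smul_le _ _).trans (hP d f hf).1, ?_⟩
  rw [LinearMap.smul_apply, coeff_smul, (hP d f hf).2, smul_mul_assoc]

theorem neg (hP : HasSymbol m P s) : HasSymbol m (-P) (-s) := by
  intro d f hf
  rw [LinearMap.neg_apply, natDegree_neg, coeff_neg, (hP d f hf).2, neg_mul]
  exact ⟨(hP d f hf).1, rfl⟩

theorem sum {ι : Type*} (F : Finset ι) {P : ι → Module.End k R[X]} {s : ι → R}
    (h : ∀ i ∈ F, HasSymbol m (P i) (s i)) : HasSymbol m (∑ i ∈ F, P i) (∑ i ∈ F, s i) := by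
  classical
  induction F using Finset.induction_on with
  | empty => simpa using zero m
  | insert i F hi ih =>
    rw [Finset.sum_insert hi, Finset.sum_insert hi]
    exact (h i (Finset.mem_insert_self _ _)).add
      (ih fun j hj => h j (Finset.mem_insert_of_mem hj))

theorem pow (hP : HasSymbol m P s) (a : ℕ) : HasSymbol (a * m) (P ^ a) (s ^ a) := by
  induction a with
  | zero => simpa using one
  | succ a ih =>
    rw [pow_succ, pow_succ, add_mul, one_mul]
    exact ih.mul hP

theorem mulLeft_C (r : R) : HasSymbol 0 (LinearMap.mulLeft k (C r)) r := by
  intro d f hf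
  rw [LinearMap.mulLeft_apply, zero_add]
  exact ⟨(natDegree_C_mul_le _ _).trans hf, coeff_C_mul f⟩

theorem twist (w : R) (D : Derivation k R R) : HasSymbol 1 (twist w D) (D w) := by
  intro d f hf
  rw [twist_apply, mul_assoc, add_comm 1 d]
  refine ⟨natDegree_add_le_of_degree_le ?_ ?_, ?_⟩
  · exact ((natDegree_coeffDeriv_le D f).trans hf).trans (Nat.le_succ d)
  · refine (natDegree_C_mul_le _ _).trans (natDegree_mul_le.trans ?_)
    have := natDegree_X_le (R := R)
    omega
  · rw [coeff_add, coeff_coeffDeriv, coeff_eq_zero_of_natDegree_lt (Nat.lt_succ_of_le hf), map_zero,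
      zero_add, coeff_C_mul, coeff_X_mul]

end HasSymbol

end Operators

end OrbitHom

/-! ### A representation of `T_n` by differential operators -/

namespace OrbitHom

section

attribute [local instance 100] LieRing.ofAssociativeRing

variable (k : Type*) [Field k] (n : ℕ)

/-- The polynomial ring in `t` (the variable `none`), the coefficients `u_j` of a polynomial
substitution (the variables `some (inl j)`) and the momenta `η_j` dual to them (the variables
`some (inr j)`). -/
abbrev Phase : Type _ := MvPolynomial (Option (Fin n ⊕ Fin n)) k

/-- The generic substitution `φ = u_0 s + u_1 s ^ 2 + ⋯ + u_(n-1) s ^ n`, as a polynomial in `s`. -/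
noncomputable def subst : (Phase k n)[X] :=
  ∑ j : Fin n, monomial (j + 1) (MvPolynomial.X (some (Sum.inl j)))

variable {k n}

theorem coeff_subst_zero : (subst k n).coeff 0 = 0 := by
  simp [subst, coeff_monomial]

theorem coeff_subst_succ (j : Fin n) :
    (subst k n).coeff (j + 1) = MvPolynomial.X (some (Sum.inl j)) := by
  simp [subst, coeff_monomial, ← Fin.ext_iff]

variable (k n)

/-- The vector field by which `f ∂` acts on the coefficients `u_j` of `φ`, that is,
`φ ↦ f(φ)` modulo `s ^ (n + 1)`. -/
noncomputable def flow : Witt k →ₗ[k] Derivation k (Phase k n) (Phase k n) where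
  toFun D := MvPolynomial.mkDerivation k fun
    | some (Sum.inl j) => (aeval (subst k n) (D X)).coeff (j + 1)
    | _ => 0
  map_add' D E := by
    refine MvPolynomial.derivation_ext fun i => ?_
    rcases i with _ | j | j <;> simp [MvPolynomial.mkDerivation_X]
  map_smul' c D := by
    refine MvPolynomial.derivation_ext fun i => ?_
    rcases i with _ | j | j <;> simp [MvPolynomial.mkDerivation_X]

variable {k n}

theorem flow_inl (D : Witt k) (j : Fin n) : flow k n D (MvPolynomial.X (some (Sum.inl j))) =
    (aeval (subst k n) (D X)).coeff (j + 1) := by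
  simp [flow, MvPolynomial.mkDerivation_X]

theorem flow_inr (D : Witt k) (j : Fin n) :
    flow k n D (MvPolynomial.X (some (Sum.inr j))) = 0 := by
  simp [flow, MvPolynomial.mkDerivation_X]

theorem flow_none (D : Witt k) : flow k n D (MvPolynomial.X none) = 0 := by
  simp [flow, MvPolynomial.mkDerivation_X]

theorem X_pow_dvd_aeval_subst {m : ℕ} {f : k[X]} (h : X ^ m ∣ f) :
    X ^ m ∣ aeval (subst k n) f := by
  obtain ⟨g, rfl⟩ := h
  rw [map_mul, map_pow, aeval_X]
  exact Dvd.dvd.mul_right (pow_dvd_pow_of_dvd (X_dvd_iff.mpr coeff_subst_zero) m) _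

/-- The defining property `φ ↦ f(φ)` of the flow, modulo `s ^ (n + 1)`. -/
theorem X_pow_dvd_coeffDeriv_subst {D : Witt k} (hD : D ∈ wittZero k) :
    X ^ (n + 1) ∣ coeffDeriv (flow k n D) (subst k n) - aeval (subst k n) (D X) := by
  rw [X_pow_dvd_iff]
  intro d hd
  rw [coeff_sub, coeff_coeffDeriv, sub_eq_zero]
  rcases d with _ | d
  · have h : X ∣ aeval (subst k n) (D X) := by
      simpa using X_pow_dvd_aeval_subst (n := n) (mem_wittSpan.mp hD)
    rw [coeff_subst_zero, map_zero, X_dvd_iff.mp h]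
  · have h := coeff_subst_succ (k := k) (⟨d, by omega⟩ : Fin n)
    have h' := flow_inl D (⟨d, by omega⟩ : Fin n)
    simp only at h h'
    rw [h, h']

/-- Applying two vector fields in succession to the coordinate `u_j`. -/
theorem flow_flow_inl {D : Witt k} (hD : D ∈ wittZero k) (E : Witt k) (j : Fin n) :
    flow k n D (flow k n E (MvPolynomial.X (some (Sum.inl j)))) =
      (aeval (subst k n) (D X * derivative (E X))).coeff (j + 1) := by
  have h : X ^ (n + 1) ∣ coeffDeriv (flow k n D) (aeval (subst k n) (E X)) -
      aeval (subst k n) (D X * derivative (E X)) := by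
    rw [Derivation.map_aeval, smul_eq_mul, map_mul, mul_comm (aeval (subst k n) (D X)), ← mul_sub]
    exact Dvd.dvd.mul_left (X_pow_dvd_coeffDeriv_subst hD) _
  have h1 := X_pow_dvd_iff.mp h (j + 1) (by omega)
  rw [coeff_sub, coeff_coeffDeriv, sub_eq_zero] at h1
  rw [flow_inl, h1]

theorem flow_lie {D E : Witt k} (hD : D ∈ wittZero k) (hE : E ∈ wittZero k) :
    flow k n ⁅D, E⁆ = ⁅flow k n D, flow k n E⁆ := by
  refine MvPolynomial.derivation_ext fun i => ?_
  rw [Derivation.commutator_apply]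
  rcases i with _ | j | j
  · simp [flow_none]
  · rw [flow_flow_inl hD, flow_flow_inl hE, flow_inl, bracket_apply_X, map_sub, coeff_sub,
      mul_comm (E X)]
  · simp [flow_inr]

theorem flow_eq_zero {D : Witt k} (hD : D ∈ wittSpan k n) : flow k n D = 0 := by
  refine MvPolynomial.derivation_ext fun i => ?_
  rw [Derivation.zero_apply]
  rcases i with _ | j | j
  · exact flow_none D
  · rw [flow_inl]
    exact X_pow_dvd_iff.mp (X_pow_dvd_aeval_subst (mem_wittSpan.mp hD)) _ (by omega)
  · exact flow_inr D j

variable (k n)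

/-- The phase `w = t + ∑ u_j η_j`. A vector field `D` on the space with coordinates `t, u_j` has
the principal symbol `D(w)`, the momentum dual to `t` being set to `1`. -/
noncomputable def phase : Phase k n :=
  MvPolynomial.X none +
    ∑ j : Fin n, MvPolynomial.X (some (Sum.inl j)) * MvPolynomial.X (some (Sum.inr j))

/-- The action of `g_n` on `R[X]`, where `R` is `Phase k n`, by the flow conjugated by `exp (w X)`. -/
noncomputable def gAction : gLie k n →ₗ⁅k⁆ Module.End k (Phase k n)[X] :=
  { (Submodule.liftQ (wittIdeal k n).toSubmodule
      (twist (phase k n) ∘ₗ flow k n ∘ₗ (wittZero k).toSubmodule.subtype)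
      (fun D hD => by
        have h : flow k n (D : Witt k) = 0 := flow_eq_zero hD
        change twist (phase k n) (flow k n (D : Witt k)) = 0
        rw [h, map_zero])) with
    map_lie' := fun {x y} => by
      obtain ⟨D, rfl⟩ := LieSubmodule.Quotient.surjective_mk' (wittIdeal k n) x
      obtain ⟨E, rfl⟩ := LieSubmodule.Quotient.surjective_mk' (wittIdeal k n) y
      change twist (phase k n) (flow k n ⁅(D : Witt k), (E : Witt k)⁆) = _
      rw [flow_lie D.2 E.2, twist_lie]
      rfl }

theorem gAction_v (i : ℕ) : gAction k n (v k n i) = twist (phase k n) (flow k n (e k i)) := rfl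

/-- The action of the Weyl algebra on `R[X]`, where `R` is `Phase k n`. -/
noncomputable def weylAction : Weyl k →ₐ[k] Module.End k (Phase k n)[X] :=
  RingQuot.liftAlgHom k ⟨FreeAlgebra.lift k fun
    | WeylGen.t => LinearMap.mulLeft k (C (MvPolynomial.X none))
    | WeylGen.d => twist (phase k n) (MvPolynomial.pderiv none), by
      rintro _ _ ⟨⟩
      ext1 f
      simp only [map_sub, map_mul, map_one, FreeAlgebra.lift_ι_apply, LinearMap.sub_apply,
        Module.End.mul_apply, twist_apply, LinearMap.mulLeft_apply, Derivation.leibniz,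
        coeffDeriv_C, MvPolynomial.pderiv_X_self, smul_eq_mul, Module.End.one_apply]
      ring⟩

theorem weylAction_wt :
    weylAction k n (wt k) = LinearMap.mulLeft k (C (MvPolynomial.X none)) := by
  refine (RingQuot.liftAlgHom_mkAlgHom_apply _ _ _ _).trans ?_
  simp [FreeAlgebra.lift_ι_apply]

theorem weylAction_wd :
    weylAction k n (wd k) = twist (phase k n) (MvPolynomial.pderiv none) := by
  refine (RingQuot.liftAlgHom_mkAlgHom_apply _ _ _ _).trans ?_
  simp [FreeAlgebra.lift_ι_apply]

variable {k n}

theorem pderiv_flow_comm (D : Witt k) :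
    ⁅(MvPolynomial.pderiv none : Derivation k (Phase k n) (Phase k n)), flow k n D⁆ = 0 := by
  have hs : coeffDeriv (MvPolynomial.pderiv none : Derivation k (Phase k n) (Phase k n))
      (subst k n) = 0 := by
    ext1 i
    rw [coeff_coeffDeriv, subst, finsetSum_coeff, map_sum, coeff_zero]
    refine Finset.sum_eq_zero fun j _ => ?_
    rw [coeff_monomial]
    split_ifs <;> simp [MvPolynomial.pderiv_X]
  refine MvPolynomial.derivation_ext fun i => ?_
  rw [Derivation.commutator_apply, Derivation.zero_apply]
  rcases i with _ | j | j
  · simp [flow_none]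
  · rw [flow_inl, ← coeff_coeffDeriv, Derivation.map_aeval, hs]
    simp [MvPolynomial.pderiv_X]
  · simp [flow_inr, MvPolynomial.pderiv_X]

theorem weylAction_comm_gAction (a : Weyl k) (x : gLie k n) :
    Commute (weylAction k n a) (gAction k n x) := by
  obtain ⟨D, rfl⟩ := LieSubmodule.Quotient.surjective_mk' (wittIdeal k n) x
  change Commute _ (twist (phase k n) (flow k n (D : Witt k)))
  obtain ⟨a, rfl⟩ := RingQuot.mkAlgHom_surjective k (WeylRel k) a
  change Commute (weylAction k n (weylMk k a)) _
  induction a using FreeAlgebra.induction with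
  | grade0 c =>
    rw [AlgHom.commutes, AlgHom.commutes]
    exact Algebra.commute_algebraMap_left _ _
  | grade1 g =>
    rcases g with _ | _
    · change Commute (weylAction k n (wt k)) _
      rw [weylAction_wt]
      ext1 f
      simp only [Module.End.mul_apply, twist_apply, LinearMap.mulLeft_apply, Derivation.leibniz,
        coeffDeriv_C, flow_none, smul_eq_mul, C_0]
      ring
    · change Commute (weylAction k n (wd k)) _
      rw [weylAction_wd]
      have h := twist_lie (phase k n) (MvPolynomial.pderiv none) (flow k n (D : Witt k))
      rw [pderiv_flow_comm, map_zero] at h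
      exact (sub_eq_zero.mp h.symm)
  | mul a b ha hb =>
    rw [map_mul, map_mul]
    exact ha.mul_left hb
  | add a b ha hb =>
    rw [map_add, map_add]
    exact ha.add_left hb

theorem weylAction_comm_lift (a : Weyl k) (y : UniversalEnvelopingAlgebra k (gLie k n)) :
    Commute (weylAction k n a) (UniversalEnvelopingAlgebra.lift k (gAction k n) y) := by
  obtain ⟨y, rfl⟩ : ∃ z, UniversalEnvelopingAlgebra.mkAlgHom k (gLie k n) z = y :=
    RingCon.mkₐ_surjective _ y
  induction y using TensorAlgebra.induction with
  | algebraMap c =>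
    rw [AlgHom.commutes, AlgHom.commutes]
    exact Algebra.commute_algebraMap_right _ _
  | ι x =>
    rw [← UniversalEnvelopingAlgebra.ι_apply, UniversalEnvelopingAlgebra.lift_ι_apply]
    exact weylAction_comm_gAction a x
  | mul b c hb hc =>
    rw [map_mul, map_mul]
    exact hb.mul_right hc
  | add b c hb hc =>
    rw [map_add, map_add]
    exact hb.add_right hc

variable (k n)

/-- The action of `T_n` by differential operators in `t` and the `u_j`, conjugated by the formal
exponential `exp (w X)` of the phase `w`. -/
noncomputable def tAction : T k n →ₐ[k] Module.End k (Phase k n)[X] :=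
  Algebra.TensorProduct.lift (weylAction k n) (UniversalEnvelopingAlgebra.lift k (gAction k n))
    weylAction_comm_lift

/-- The symbol of `v_i`. -/
noncomputable def vSymbol (i : ℕ) : Phase k n := flow k n (e k i) (phase k n)

variable {k n}

theorem hasSymbol_wt : HasSymbol 0 (tAction k n (wt k ⊗ₜ 1)) (MvPolynomial.X none) := by
  rw [tAction, Algebra.TensorProduct.lift_tmul, map_one, mul_one, weylAction_wt]
  exact HasSymbol.mulLeft_C _

theorem hasSymbol_wd : HasSymbol 1 (tAction k n (wd k ⊗ₜ 1)) 1 := by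
  rw [tAction, Algebra.TensorProduct.lift_tmul, map_one, mul_one, weylAction_wd]
  have h : MvPolynomial.pderiv none (phase k n) = 1 := by
    simp [phase, MvPolynomial.pderiv_X]
  simpa only [h] using HasSymbol.twist (phase k n) (MvPolynomial.pderiv none)

theorem hasSymbol_uv (i : ℕ) : HasSymbol 1 (tAction k n (1 ⊗ₜ uv k n i)) (vSymbol k n i) := by
  rw [tAction, Algebra.TensorProduct.lift_tmul, map_one, one_mul, uv,
    UniversalEnvelopingAlgebra.lift_ι_apply, gAction_v]
  exact HasSymbol.twist _ _

variable (k n) in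
/-- Specialisation to the identity substitution `φ = s`. -/
noncomputable def atIdentity : Phase k n →ₐ[k] Phase k n :=
  MvPolynomial.aeval fun
    | none => MvPolynomial.X none
    | some (Sum.inl j) => if (j : ℕ) = 0 then 1 else 0
    | some (Sum.inr j) => MvPolynomial.X (some (Sum.inr j))

/-- At the identity substitution the symbol of `v_i` is the momentum `η_i`. -/
theorem atIdentity_vSymbol (i : Fin n) :
    atIdentity k n (vSymbol k n i) = MvPolynomial.X (some (Sum.inr i)) := by
  set θ : Phase k n →ₐ[k] Phase k n := atIdentity k n with hθ
  have hn : 0 < n := Nat.pos_of_ne_zero fun h => by have := i.2; omega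
  have hs : (subst k n).map (θ : Phase k n →+* Phase k n) = X := by
    rw [subst, Polynomial.map_sum, Finset.sum_eq_single ⟨0, hn⟩]
    · simp [hθ, atIdentity, monomial_one_one_eq_X]
    · intro j _ hj
      have : (j : ℕ) ≠ 0 := fun h => hj (Fin.ext h)
      simp [hθ, atIdentity, this]
    · simp
  have h : ∀ j : Fin n, θ (((subst k n) ^ (i + 1 : ℕ)).coeff (j + 1)) = if i = j then 1 else 0 := by
    intro j
    have : θ (((subst k n) ^ (i + 1 : ℕ)).coeff (j + 1)) =
        (((subst k n) ^ (i + 1 : ℕ)).map (θ : Phase k n →+* Phase k n)).coeff (j + 1) := by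
      rw [coeff_map]
      rfl
    rw [this, Polynomial.map_pow, hs, coeff_X_pow]
    simp [Fin.ext_iff, eq_comm]
  simp only [vSymbol, phase, map_add, map_sum, flow_none, Derivation.leibniz, flow_inl, flow_inr,
    zero_add, smul_eq_mul, map_mul, e, vf_apply_X, map_pow, aeval_X, h]
  simp [hθ, atIdentity]

end

end OrbitHom

/-! ### Moments of a point-supported functional -/

namespace OrbitHom

section Moments

variable {K : Type*} [CommRing K]

/-- The value on `s ^ j` of the functional `f ↦ ∑_{i ≤ n} Y_i f^(i)(x) / i!` supported at the
point `x`, where `f^(i) / i!` is the Hasse derivative. For `i > j` the truncated exponent `j - i` is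
harmless, as the binomial coefficient vanishes. -/
noncomputable def moment (n : ℕ) (x : K) (Y : ℕ → K) (j : ℕ) : K :=
  ∑ i ∈ Finset.range (n + 1), (j.choose i : K) * x ^ (j - i) * Y i

/-- The value of the functional on `(s - x) ^ N`, expanded in powers of `s`. -/
theorem sum_moment (n : ℕ) (x : K) (Y : ℕ → K) (N : ℕ) :
    ∑ j ∈ Finset.range (N + 1), (-x) ^ (N - j) * (N.choose j : K) * moment n x Y j =
      if N ≤ n then Y N else 0 := by
  -- The functional itself; its Taylor form makes its values on powers of `X - x` evident.
  let L : K[X] →ₗ[K] K :=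
    ∑ i ∈ Finset.range (n + 1), LinearMap.mulRight K (Y i) ∘ₗ lcoeff K i ∘ₗ (taylor x)
  have hL : ∀ f, L f = ∑ i ∈ Finset.range (n + 1), (taylor x f).coeff i * Y i := by
    intro f
    simp [L]
  have h1 : ∀ j, L (X ^ j) = moment n x Y j := by
    intro j
    rw [hL, moment]
    refine Finset.sum_congr rfl fun i _ => ?_
    rw [taylor_X_pow, coeff_X_add_C_pow]
    ring
  have h2 : L ((X + C (-x)) ^ N) = if N ≤ n then Y N else 0 := by
    have h3 : taylor x ((X + C (-x)) ^ N) = X ^ N := by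
      rw [taylor_pow, map_add, taylor_X, taylor_C, add_assoc, ← C_add, add_neg_cancel, C_0,
        add_zero]
    rw [hL, h3]
    simp only [coeff_X_pow, ite_mul, one_mul, zero_mul, Finset.sum_ite_eq', Finset.mem_range,
      Nat.lt_succ_iff]
  rw [← h2, add_pow, map_sum]
  refine Finset.sum_congr rfl fun j _ => ?_
  have h4 : X ^ j * C (-x) ^ (N - j) * ((N.choose j : ℕ) : K[X]) =
      ((-x) ^ (N - j) * (N.choose j : K)) • X ^ j := by
    rw [smul_eq_C_mul, C_mul, C_pow, map_natCast]
    ring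
  rw [h4, map_smul, h1, smul_eq_mul]

variable {n : ℕ} {x : K} {Y : ℕ → K} {A : Type*} [CommRing A] [Algebra A K]

theorem moment_zero (hY : Y 0 = 1) : moment n x Y 0 = 1 := by
  rw [moment, Finset.sum_range_succ']
  simp [hY]

/-- The support of a normalised functional is integral over any ring which contains the first
`n + 1` moments, since the functional vanishes on `(s - x) ^ (n + 1)`. -/
theorem isIntegral_of_moment (hY : Y 0 = 1)
    (h : ∀ j, 0 < j → j ≤ n + 1 → moment n x Y j ∈ Set.range (algebraMap A K)) :
    IsIntegral A x := by
  choose! a ha using h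
  -- `X ^ (n + 1) + q` is the expansion of `(-1) ^ (n + 1) (s - x) ^ (n + 1)` in which each `s ^ j` is
  -- replaced by its moment `a j` and `x` by `X`; the moment of `s ^ 0` is `1`.
  let q : A[X] := ∑ j ∈ Finset.range (n + 1),
    C ((-1) ^ (j + 1) * ((n + 1).choose (j + 1) : A) * a (j + 1)) * X ^ (n - j)
  have hq : q.degree < (n + 1 : ℕ) := by
    refine (degree_sum_le _ _).trans_lt ((Finset.sup_lt_iff (WithBot.bot_lt_coe _)).mpr ?_)
    intro j _
    refine (degree_C_mul_X_pow_le _ _).trans_lt ?_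
    exact_mod_cast (by omega : n - j < n + 1)
  refine ⟨X ^ (n + 1) + q, monic_X_pow_add hq, ?_⟩
  have h0 := sum_moment n x Y (n + 1)
  rw [if_neg (by omega), Finset.sum_range_succ'] at h0
  have h1 := congrArg (fun z => (-1) ^ (n + 1) * z) h0
  simp only [moment_zero hY, mul_zero, mul_add, Finset.mul_sum] at h1
  rw [eval₂_add, eval₂_X_pow, ← h1, add_comm, eval₂_finsetSum]
  refine congrArg₂ _ (Finset.sum_congr rfl fun j hj => ?_) ?_
  · rw [Finset.mem_range] at hj
    rw [eval₂_mul, eval₂_C, eval₂_X_pow, map_mul, map_mul, ha (j + 1) (by omega) (by omega),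
      map_pow, map_neg, map_one, map_natCast, Nat.add_sub_add_right, neg_pow x]
    obtain ⟨l, rfl⟩ : ∃ l, n = j + l := ⟨n - j, by omega⟩
    have hs : ((-1 : K)) ^ (j + l + 1) * (-1) ^ (j + l - j) = (-1) ^ (j + 1) := by
      rw [Nat.add_sub_cancel_left, ← pow_add, show j + l + 1 + l = (j + 1) + 2 * l by ring,
        pow_add, pow_mul]
      simp
    rw [← hs]
    ring
  · rw [neg_pow x]
    simp [← mul_pow]

/-- The coefficients `Y_N` are the values of the functional on `(s - x) ^ N`. -/
theorem mem_adjoin_of_moment (hY : Y 0 = 1)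
    (h : ∀ j, 0 < j → j ≤ n + 1 → moment n x Y j ∈ Set.range (algebraMap A K))
    {N : ℕ} (hN : N ≤ n) : Y N ∈ Algebra.adjoin A {x} := by
  have h0 := sum_moment n x Y N
  rw [if_pos hN] at h0
  rw [← h0]
  refine sum_mem fun j hj => mul_mem (mul_mem (pow_mem (neg_mem ?_) _) (natCast_mem _ _)) ?_
  · exact Algebra.self_mem_adjoin_singleton A x
  · rcases Nat.eq_zero_or_pos j with rfl | hj0
    · rw [moment_zero hY]
      exact one_mem _
    · rw [Finset.mem_range] at hj
      obtain ⟨a, ha⟩ := h j hj0 (by omega)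
      rw [← ha]
      exact Subalgebra.algebraMap_mem _ a

end Moments

section SupportAlgebra

variable (k : Type*) [Field k] {K : Type*} [CommRing K] [Algebra k K]
variable (n : ℕ) (x : K) (Y : ℕ → K)

/-- The algebra generated by the first `n + 1` moments. -/
noncomputable def momentAlg : Subalgebra k K :=
  Algebra.adjoin k ((fun m => moment n x Y (m + 1)) '' Set.Iic n)

/-- The algebra generated by the support of the functional over the algebra of moments. -/
noncomputable def supportAlg : Subalgebra (momentAlg k n x Y) K :=
  Algebra.adjoin (momentAlg k n x Y) {x}

/-- The additive group of `supportAlg`, in which the symbols of `(T_n)_0` turn out to lie. -/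
noncomputable def supportGroup : AddSubgroup K :=
  (Subalgebra.toSubmodule (supportAlg k n x Y)).toAddSubgroup

variable {n x Y}

theorem moment_mem_range (j : ℕ) (h0 : 0 < j) (hj : j ≤ n + 1) :
    moment n x Y j ∈ Set.range (algebraMap (momentAlg k n x Y) K) := by
  obtain ⟨m, rfl⟩ := Nat.exists_eq_succ_of_ne_zero h0.ne'
  exact ⟨⟨_, Algebra.subset_adjoin ⟨m, Nat.lt_succ_iff.mp hj, rfl⟩⟩, rfl⟩

theorem isNoetherian_supportAlg (hY : Y 0 = 1) :
    IsNoetherian (momentAlg k n x Y) (Subalgebra.toSubmodule (supportAlg k n x Y)) := by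
  have : IsNoetherianRing (momentAlg k n x Y) :=
    isNoetherianRing_of_fg (Subalgebra.fg_def.mpr ⟨_, (Set.finite_Iic n).image _, rfl⟩)
  exact isNoetherian_of_fg_of_noetherian _
    (isIntegral_of_moment hY (moment_mem_range k)).fg_adjoin_singleton

theorem prod_mem_supportGroup (hY : Y 0 = 1) (a : ℕ) (m : Fin n → ℕ) :
    x ^ a * ∏ i : Fin n, Y (i + 1) ^ m i ∈ supportGroup k n x Y := by
  have h : x ^ a * ∏ i : Fin n, Y (i + 1) ^ m i ∈ supportAlg k n x Y :=
    mul_mem (pow_mem (Algebra.self_mem_adjoin_singleton _ _) _)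
      (prod_mem fun i _ => pow_mem (mem_adjoin_of_moment hY (moment_mem_range k) i.2) _)
  exact h

theorem smul_mem_supportGroup (c : k) {y : K} (hy : y ∈ supportGroup k n x Y) :
    c • y ∈ supportGroup k n x Y := by
  have h := Subalgebra.smul_mem (supportAlg k n x Y) hy (algebraMap k (momentAlg k n x Y) c)
  rwa [algebraMap_smul] at h

/-- A ring whose symbols lie in `supportGroup` and include the moments is Noetherian. -/
theorem SymbolCalculus.isNoetherianRing_of_moment {B R : Type*} [Ring B] [CommRing R] [Algebra k R]
    {rel : ℕ → B → R → Prop} {n : ℕ} {x : R[X]} {Y : ℕ → R[X]}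
    (h : SymbolCalculus (supportGroup k n x Y) rel) (hY : Y 0 = 1)
    (hc : ∀ c : k, ∃ b, rel 0 b (algebraMap k R c))
    (hm : ∀ m, ∃ b s, rel (m + 1) b s ∧ monomial (m + 1) s = moment n x Y (m + 1)) :
    IsNoetherianRing B := by
  have hN := isNoetherian_supportAlg (x := x) (n := n) k hY
  refine h.isNoetherianRing (A := momentAlg k n x Y) ?_
    (Subalgebra.toSubmodule (supportAlg k n x Y)) le_rfl
  rintro ⟨c, hc'⟩
  change c ∈ h.gr ⊤
  induction hc' using Algebra.adjoin_induction with
  | mem c hc =>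
    obtain ⟨m, -, rfl⟩ := hc
    obtain ⟨b, s, hs, he⟩ := hm m
    simp only
    rw [← he]
    exact h.monomial_mem_gr (AddSubgroup.mem_top b) hs
  | algebraMap c =>
    obtain ⟨b, hb⟩ := hc c
    exact h.monomial_mem_gr (AddSubgroup.mem_top b) hb
  | add c d _ _ hc hd => exact add_mem hc hd
  | mul c d _ _ hc hd => exact h.mul_mem_gr ⊤ hc hd

end SupportAlgebra

/-! ### Symbols of the elements of degree zero -/

section

variable (k : Type*) [Field k] (n : ℕ)

/-- The symbol of `t ∂`, in degree `1`. -/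
noncomputable def euler : (Phase k n)[X] := monomial 1 (MvPolynomial.X none)

/-- The symbol of `∂ ^ i v_i`, in degree `i + 1`, at index `i + 1`, and `1` at index `0`. -/
noncomputable def momentum : ℕ → (Phase k n)[X]
  | 0 => 1
  | i + 1 => monomial (i + 1) (vSymbol k n i)

variable {k n}

/-- The symbol of the ordered monomial `t ^ a ∂ ^ b v ^ m`; it does not depend on `b`, since the
symbol of `∂` is `1`. -/
noncomputable def monSymbol (a : ℕ) (m : Fin n → ℕ) : Phase k n :=
  MvPolynomial.X none ^ a * ∏ i : Fin n, vSymbol k n i ^ m i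

theorem hasSymbol_tMon (a b : ℕ) (m : Fin n → ℕ) :
    HasSymbol (b + ∑ i, m i) (tAction k n (tMon k n a b m)) (monSymbol a m) := by
  have hl : ∀ l : List (Fin n), HasSymbol (l.map m).sum
      (tAction k n (1 ⊗ₜ (l.map fun i : Fin n => uv k n i ^ m i).prod))
      (l.map fun i : Fin n => vSymbol k n i ^ m i).prod := by
    intro l
    induction l with
    | nil =>
      simp only [List.map_nil, List.prod_nil, List.sum_nil]
      rw [← Algebra.TensorProduct.one_def, map_one]
      exact HasSymbol.one
    | cons i l ih =>
      have h : (1 : Weyl k) ⊗ₜ[k] (((i :: l).map fun i : Fin n => uv k n i ^ m i).prod) =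
          (1 ⊗ₜ uv k n i) ^ m i * 1 ⊗ₜ (l.map fun i : Fin n => uv k n i ^ m i).prod := by
        rw [Algebra.TensorProduct.tmul_pow, Algebra.TensorProduct.tmul_mul_tmul, one_pow, one_mul,
          List.map_cons, List.prod_cons]
      rw [h, map_mul, map_pow, List.map_cons, List.map_cons, List.prod_cons, List.sum_cons]
      have h1 := (hasSymbol_uv (k := k) (n := n) i).pow (m i)
      rw [mul_one] at h1
      exact h1.mul ih
  have h : tMon k n a b m = (wt k ⊗ₜ 1) ^ a * (wd k ⊗ₜ 1) ^ b *
      1 ⊗ₜ ((List.finRange n).map fun i : Fin n => uv k n i ^ m i).prod := by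
    rw [tMon, List.ofFn_eq_map, Algebra.TensorProduct.tmul_pow, Algebra.TensorProduct.tmul_pow,
      Algebra.TensorProduct.tmul_mul_tmul, Algebra.TensorProduct.tmul_mul_tmul]
    simp
  have h1 := ((hasSymbol_wt (k := k) (n := n)).pow a).mul
    ((hasSymbol_wd (k := k) (n := n)).pow b) |>.mul (hl (List.finRange n))
  rw [h, map_mul, map_mul, map_pow, map_pow]
  simpa [monSymbol, ← List.ofFn_eq_map, List.prod_ofFn, List.sum_ofFn] using h1

/-- The symbol of a monomial of degree zero is a monomial in the symbols of `t ∂` and the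
`∂ ^ i v_i`. -/
theorem monomial_monSymbol_mem {a b : ℕ} {m : Fin n → ℕ}
    (h : (a : ℤ) - b + ∑ i : Fin n, (i : ℤ) * m i = 0) :
    monomial (b + ∑ i, m i) (monSymbol a m : Phase k n) ∈
      supportGroup k n (euler k n) (momentum k n) := by
  have hb : b + ∑ i, m i = a + ∑ i : Fin n, ((i : ℕ) + 1) * m i := by
    have : (b : ℤ) = a + ∑ i : Fin n, (i : ℤ) * m i := by linarith
    zify
    rw [this]
    simp only [add_mul, one_mul, Finset.sum_add_distrib]
    ring
  have hp : ∀ F : Finset (Fin n), ∏ i ∈ F, momentum k n (i + 1) ^ m i =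
      monomial (∑ i ∈ F, ((i : ℕ) + 1) * m i) (∏ i ∈ F, vSymbol k n i ^ m i) := by
    intro F
    classical
    induction F using Finset.induction_on with
    | empty => simp
    | insert i F hi ih =>
      rw [Finset.prod_insert hi, Finset.prod_insert hi, Finset.sum_insert hi, ih, momentum,
        monomial_pow, monomial_mul_monomial]
  have he : monomial (b + ∑ i, m i) (monSymbol a m : Phase k n) =
      euler k n ^ a * ∏ i : Fin n, momentum k n (i + 1) ^ m i := by
    rw [hp, euler, monomial_pow, monomial_mul_monomial, one_mul, hb, monSymbol]
  rw [he]
  exact prod_mem_supportGroup k rfl a m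

/-- The exponent of the monomial `t ^ a η ^ m`. -/
noncomputable def expo (a : ℕ) (m : Fin n → ℕ) : Option (Fin n ⊕ Fin n) →₀ ℕ :=
  Finsupp.equivFunOnFinite.symm fun
    | none => a
    | some (Sum.inl _) => 0
    | some (Sum.inr i) => m i

/-- The symbols of distinct ordered monomials become distinct monomials at the identity
substitution; in particular they are linearly independent. -/
theorem atIdentity_monSymbol (a : ℕ) (m : Fin n → ℕ) :
    atIdentity k n (monSymbol a m) = MvPolynomial.monomial (expo a m) 1 := by
  have ht : atIdentity k n (MvPolynomial.X none) = MvPolynomial.X none := by simp [atIdentity]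
  rw [monSymbol, map_mul, map_prod, map_pow, ht]
  simp only [map_pow, atIdentity_vSymbol]
  rw [MvPolynomial.monomial_eq, Finsupp.prod_fintype _ _ (by simp)]
  simp [expo, Fintype.prod_option, Fintype.prod_sum_type]

theorem expo_injective {a a' : ℕ} {m m' : Fin n → ℕ} (h : expo a m = expo a' m') :
    a = a' ∧ m = m' :=
  ⟨DFunLike.congr_fun h none, funext fun i => DFunLike.congr_fun h (some (Sum.inr i))⟩

/-- A nonzero element of degree zero has a nonzero symbol, and the symbol lies in the algebra of
symbols. It is the sum of the symbols of the ordered monomials of maximal order. -/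
theorem exists_symbol {x : T k n} (hx : x ∈ tDeg k n 0) (h0 : x ≠ 0) :
    ∃ m s, s ≠ 0 ∧ HasSymbol m (tAction k n x) s ∧
      monomial m s ∈ supportGroup k n (euler k n) (momentum k n) := by
  classical
  let f : ℕ × ℕ × (Fin n → ℕ) → T k n := fun c => tMon k n c.1 c.2.1 c.2.2
  let Z : Set (ℕ × ℕ × (Fin n → ℕ)) :=
    {c | (c.1 : ℤ) - c.2.1 + ∑ i : Fin n, (i : ℤ) * c.2.2 i = 0}
  have hx' : x ∈ Submodule.span k (f '' Z) := by
    refine Submodule.span_mono ?_ hx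
    rintro _ ⟨a, b, m, h, rfl⟩
    exact ⟨(a, b, m), h, rfl⟩
  obtain ⟨l, hl, rfl⟩ := (Finsupp.mem_span_image_iff_linearCombination k).mp hx'
  have hne : l.support.Nonempty := by
    rw [Finsupp.support_nonempty_iff]
    rintro rfl
    exact h0 (map_zero _)
  let ord : ℕ × ℕ × (Fin n → ℕ) → ℕ := fun c => c.2.1 + ∑ i, c.2.2 i
  let sym : ℕ × ℕ × (Fin n → ℕ) → Phase k n := fun c => monSymbol c.1 c.2.2
  obtain ⟨c₀, hc₀, hord⟩ := Finset.exists_mem_eq_sup l.support hne ord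
  have hle : ∀ c ∈ l.support, ord c ≤ ord c₀ := fun c hc => hord ▸ Finset.le_sup hc
  let s : Phase k n := ∑ c ∈ l.support, if ord c = ord c₀ then l c • sym c else 0
  refine ⟨ord c₀, s, fun hs => ?_, ?_, ?_⟩
  · have h1 := congrArg (fun z => MvPolynomial.coeff (expo c₀.1 c₀.2.2) (atIdentity k n z)) hs
    simp only [s, map_sum, map_zero, MvPolynomial.coeff_zero, MvPolynomial.coeff_sum] at h1
    rw [Finset.sum_eq_single c₀] at h1
    · rw [if_pos rfl, map_smul, atIdentity_monSymbol, MvPolynomial.coeff_smul, MvPolynomial.coeff_monomial,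
        if_pos rfl, smul_eq_mul, mul_one] at h1
      exact Finsupp.mem_support_iff.mp hc₀ h1
    · intro c _ hcc
      split_ifs with ho
      · rw [map_smul, atIdentity_monSymbol, MvPolynomial.coeff_smul,
          MvPolynomial.coeff_monomial, if_neg, smul_zero]
        intro he
        obtain ⟨ha, hm⟩ := expo_injective he
        refine hcc (Prod.ext ha (Prod.ext ?_ hm))
        simp only [ord, hm] at ho
        omega
      · rw [map_zero, MvPolynomial.coeff_zero]
    · exact fun h => absurd hc₀ h
  · rw [Finsupp.linearCombination_apply, Finsupp.sum, map_sum]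
    refine HasSymbol.sum _ fun c hc => ?_
    have hs := (hasSymbol_tMon (k := k) c.1 c.2.1 c.2.2).smul (l c)
    rw [map_smul]
    split_ifs with ho
    · rw [← ho]
      exact hs
    · exact hs.raise (lt_of_le_of_ne (hle c hc) ho)
  · rw [map_sum]
    refine sum_mem fun c hc => ?_
    split_ifs with ho
    · rw [← smul_monomial, ← ho]
      have hc' : c ∈ Z := (Finsupp.mem_supported k l).mp hl hc
      exact smul_mem_supportGroup k (l c) (monomial_monSymbol_mem hc')
    · rw [map_zero]
      exact zero_mem _

end

/-! ### The generators `Ψ_n(e_{-1} ^ m e_m)` -/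

section

variable {k : Type*} [Field k] [CharZero k] {n : ℕ}

theorem psiLin_e (m : ℕ) : psiLin k n (e k m) =
    (wt k ⊗ₜ 1) ^ (m + 1) * (wd k ⊗ₜ 1) +
      ∑ i ∈ Finset.range n, ((m + 1).choose (i + 1) : k) •
        ((wt k ⊗ₜ 1) ^ (m - i) * (1 ⊗ₜ uv k n i)) := by
  rw [psiLin_eq, e, vf_apply_X]
  simp only [Algebra.TensorProduct.tmul_pow, Algebra.TensorProduct.tmul_mul_tmul, one_pow, mul_one,
    one_mul, map_pow, aeval_X]
  refine congrArg₂ _ rfl (Finset.sum_congr rfl fun i _ => ?_)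
  rw [← monomial_one_right_eq_X_pow, hasseDeriv_monomial, aeval_monomial, mul_one,
    Nat.add_sub_add_right, ← Algebra.smul_def, TensorProduct.smul_tmul']

theorem wd_mem_B : (wd k ⊗ₜ 1 : T k n) ∈ B k n := by
  refine ⟨UniversalEnvelopingAlgebra.ι k (vf k 1), ?_⟩
  refine (orbitHom_ι k n (vf k 1)).trans ?_
  rw [psiLin_eq, vf_apply_X]
  simp [hasseDeriv_apply_one _ (Nat.succ_pos _)]

theorem psiLin_mem_B (D : Witt k) : psiLin k n D ∈ B k n :=
  ⟨UniversalEnvelopingAlgebra.ι k D, orbitHom_ι k n D⟩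

theorem psiLin_e_mem_tDeg (m : ℕ) : psiLin k n (e k m) ∈ tDeg k n m := by
  have ht : (wt k ⊗ₜ 1 : T k n) ∈ tDeg k n 1 := by
    simpa [tGen, tGenDeg] using word_mem_tDeg k n [0]
  have hd : (wd k ⊗ₜ 1 : T k n) ∈ tDeg k n (-1) := by
    simpa [tGen, tGenDeg] using word_mem_tDeg k n [1]
  rw [psiLin_e]
  refine add_mem ?_ (sum_mem fun i hi => ?_)
  · have h := SetLike.GradedMul.mul_mem (SetLike.pow_mem_graded (m + 1) ht) hd
    convert h using 1
    simp
  · rcases le_or_gt i m with him | him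
    · have hv : (1 ⊗ₜ uv k n i : T k n) ∈ tDeg k n i := by
        simpa only [tGen, tGenDeg, List.map_cons, List.map_nil, List.prod_singleton,
          List.sum_singleton, Fin.cons_succ] using
          word_mem_tDeg k n [(⟨i, Finset.mem_range.mp hi⟩ : Fin n).succ.succ]
      refine Submodule.smul_mem _ _ ?_
      have h := SetLike.GradedMul.mul_mem (SetLike.pow_mem_graded (m - i) ht) hv
      convert h using 1
      simp [Nat.cast_sub him]
    · rw [Nat.choose_eq_zero_of_lt (by omega), Nat.cast_zero, zero_smul]
      exact zero_mem _

theorem wd_pow_mul_psiLin_mem_BZero (m : ℕ) :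
    (wd k ⊗ₜ 1) ^ m * psiLin k n (e k m) ∈ BZero k n := by
  have hd : (wd k ⊗ₜ 1 : T k n) ∈ tDeg k n (-1) := by
    simpa [tGen, tGenDeg] using word_mem_tDeg k n [1]
  refine ⟨mul_mem (pow_mem wd_mem_B m) (psiLin_mem_B _), ?_⟩
  have h := SetLike.GradedMul.mul_mem (SetLike.pow_mem_graded m hd) (psiLin_e_mem_tDeg m)
  change _ ∈ tDeg k n 0
  convert h using 1
  simp

/-- The symbol of `Ψ_n(e_{-1} ^ m e_m)` is a moment. -/
theorem exists_hasSymbol_moment (m : ℕ) : ∃ s,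
    HasSymbol (m + 1) (tAction k n ((wd k ⊗ₜ 1) ^ m * psiLin k n (e k m))) s ∧
      monomial (m + 1) s = moment n (euler k n) (momentum k n) (m + 1) := by
  have ht : ∀ a, HasSymbol 0 (tAction k n (wt k ⊗ₜ 1) ^ a) (MvPolynomial.X none ^ a) := by
    intro a
    simpa using (hasSymbol_wt (k := k) (n := n)).pow a
  have h1 := (((ht (m + 1)).mul (hasSymbol_wd (k := k) (n := n))).add
    (HasSymbol.sum (Finset.range n) fun i _ =>
      ((ht (m - i)).mul (hasSymbol_uv (k := k) (n := n) i)).smul ((m + 1).choose (i + 1) : k)))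
  have h2 := ((hasSymbol_wd (k := k) (n := n)).pow m).mul h1
  rw [mul_one, zero_add, one_pow, one_mul] at h2
  have h3 := congrArg (fun z => tAction k n ((wd k ⊗ₜ 1) ^ m * z)) (psiLin_e (k := k) (n := n) m)
  simp only [map_mul, map_pow, map_add, map_sum, map_smul] at h3
  rw [← h3, ← map_pow, ← map_mul] at h2
  refine ⟨_, h2, ?_⟩
  rw [moment, Finset.sum_range_succ', map_add, map_sum, add_comm]
  refine congrArg₂ _ (Finset.sum_congr rfl fun i _ => ?_) ?_
  · rcases le_or_gt i m with him | him
    · rw [momentum, euler, monomial_pow, ← C_eq_natCast, C_mul_monomial, monomial_mul_monomial]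
      congr 2
      · omega
      · rw [Nat.add_sub_add_right, Algebra.smul_def, map_natCast, mul_assoc]
    · rw [Nat.choose_eq_zero_of_lt (by omega)]
      simp
  · simp [momentum, euler, monomial_pow]

variable (k n)

theorem symbolCalculus_BZero : SymbolCalculus (supportGroup k n (euler k n) (momentum k n))
    fun m (b : BZero k n) s => HasSymbol m (tAction k n b) s where
  zero m := by simpa using HasSymbol.zero m
  one := by simpa using HasSymbol.one
  add hb hc := by simpa using hb.add hc
  neg hb := by simpa using hb.neg
  mul hb hc := by simpa using hb.mul hc
  raise hb h := hb.raise h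
  unique hb hc := hb.unique hc
  exists_ne {b} hb := exists_symbol b.2.2 fun h => hb (Subtype.ext h)

variable {k n}

theorem exists_BZero_hasSymbol_algebraMap (c : k) :
    ∃ b : BZero k n, HasSymbol 0 (tAction k n b) (algebraMap k (Phase k n) c) := by
  refine ⟨algebraMap k (BZero k n) c, ?_⟩
  have h := (HasSymbol.one (k := k) (R := Phase k n)).smul c
  rw [← Algebra.algebraMap_eq_smul_one, ← Algebra.algebraMap_eq_smul_one] at h
  rwa [← AlgHom.commutes (tAction k n)] at h

theorem exists_BZero_hasSymbol_moment (m : ℕ) :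
    ∃ (b : BZero k n) (s : Phase k n), HasSymbol (m + 1) (tAction k n b) s ∧
      monomial (m + 1) s = moment n (euler k n) (momentum k n) (m + 1) := by
  obtain ⟨s, hs⟩ := exists_hasSymbol_moment (k := k) (n := n) m
  exact ⟨⟨_, wd_pow_mul_psiLin_mem_BZero m⟩, s, hs⟩

end

end OrbitHom

theorem theorem1p3 (k : Type*) [Field k] [CharZero k] (n : ℕ) :
    IsNoetherianRing (OrbitHom.BZero k n) ∧
      IsNoetherianRing (OrbitHom.BZero k n)ᵐᵒᵖ ∧
        IsDomain (OrbitHom.BZero k n) := by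
  have h := OrbitHom.symbolCalculus_BZero k n
  refine ⟨h.isNoetherianRing_of_moment k rfl OrbitHom.exists_BZero_hasSymbol_algebraMap
      OrbitHom.exists_BZero_hasSymbol_moment,
    h.op.isNoetherianRing_of_moment k rfl (fun c => ?_) fun m => ?_, h.isDomain⟩
  · obtain ⟨b, hb⟩ := OrbitHom.exists_BZero_hasSymbol_algebraMap (n := n) c
    exact ⟨MulOpposite.op b, hb⟩
  · obtain ⟨b, hb⟩ := OrbitHom.exists_BZero_hasSymbol_moment (k := k) (n := n) m
    exact ⟨MulOpposite.op b, hb⟩
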